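/- **The language.** Finitary HEPCF is given by finitely many ground types $B$ (among them $\mathtt{Unit}$), finitely many constants $v$, each of a ground type (with $()$ the only constant of type $\mathtt{Unit}$), and finitely many algebraic operations $\sigma : B \rightsquigarrow k$ with a ground parameter type $B$ and an arity $k\in\mathbb N$. Its syntax is $$T,U ::= B \mid \mathsf{k} \mid T\to_E U,\qquad V,W ::= v\mid \underline n\mid x\mid \lambda x.C\mid \mathtt{fix}\,f.V,$$ $$C,D ::= V\,W\mid \sigma(V;x.C)\mid \mathtt{return}(V)\mid \mathtt{let}\ x=C\ \mathtt{in}\ D\mid \mathtt{handle}\ H\ C\mid \mathtt{case}(V;C_0,\dots,C_{k-1}),$$ $$H ::= \{\mathtt{return}(x)\mapsto C_r\}\cup\{\sigma_i(x;r)\mapsto C_i\mid 1\le i\le n\},$$ where $\mathsf k$ is the enumeration type with values $\underline 0,\dots,\underline{k-1}$ and $E$ ranges over sets of operations. The judgments $\Gamma\vdash V:T$ and $\Gamma\vdash_E C:T$ ("$C$ has type $T$ and performs at most the operations in $E$") are those of the simply typed fine-grained call-by-value calculus: $\lambda x.C:T\to_E U$ if $\Gamma,x:T\vdash_E C:U$;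 $\mathtt{fix}\,f.V:T\to_E U$ if $V$ has this type in $\Gamma,f:T\to_E U$; $\Gamma\vdash_E V\,W:U$ if $V:T\to_E U$ and $W:T$; $\Gamma\vdash_E\sigma(V;x.C):T$ if $\sigma:B\rightsquigarrow k$ is in $E$, $V:B$ and $\Gamma,x:\mathsf k\vdash_E C:T$; and $\Gamma\vdash_E\mathtt{handle}\ H\ C:T$ if $\Gamma\vdash_{E'}C:U$, where $E'=\{\sigma_i:B_i\rightsquigarrow k_i\mid 1\le i\le n\}$ is exactly the set of operations handled by $H$, $\Gamma,x:U\vdash_E C_r:T$ and $\Gamma,x:B_i,r:\mathsf k_i\to_E T\vdash_E C_i:T$ for all $i$; the rules for the remaining constructs are the usual ones. Reduction $\to$ is call by value: $(\lambda x.C)W\to C[W/x]$; $(\mathtt{fix}\,f.V)W\to V[\mathtt{fix}\,f.V/f]\,W$; $\mathtt{case}(\underline n;C_0,\dots,C_{k-1})\to C_n$; $\mathtt{let}\ x=\mathtt{return}(V)\ \mathtt{in}\ C\to C[V/x]$; $\mathtt{let}\ x=\sigma(V;y.C)\ \mathtt{in}\ D\to\sigma(V;y.\,\mathtt{let}\ x=C\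 \mathtt{in}\ D)$; $\mathtt{handle}\ H\ \mathtt{return}(V)\to C_r[V/x]$; $\mathtt{handle}\ H\ \sigma_i(V;y.C)\to C_i[V/x,\ (\lambda y.\,\mathtt{handle}\ H\ C)/r]$ (deep handlers); and reduction is allowed in $\mathtt{let}\ x=[\,]\ \mathtt{in}\ D$ and in $\mathtt{handle}\ H\ [\,]$. **Effect trees.** For $\vdash_E C:T$ the effect tree $ET(C)$ is the possibly infinite tree over the signature $\Sigma_{E,T}=\{\sigma:k+1\mid(\sigma:B\rightsquigarrow k)\in E\}\cup\{\mathtt{return}(V):0\mid\ \vdash V:T\}\cup\{v:0\mid v\text{ a constant}\}$, extended with a leaf $\bot$, that is defined coinductively by: $ET(C)=\mathtt{return}(V)$ if $C\to^*\mathtt{return}(V)$; $ET(C)=\sigma(v,ET(D[\underline 0/x]),\dots,ET(D[\underline{k-1}/x]))$ if $C\to^*\sigma(v;x.D)$ with $\sigma:B\rightsquigarrow k$; and $ET(C)=\bot$ if $C$ diverges. **Model checking.** MSO properties are given by alternating parity tree automata (APTs), that is, by a finite set $Q$ of states, an initial state, a priority function $Q\to\mathbb N$, and for every state $q$ and symbol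 $f$ (of the signature, or $\bot$, which is read as a nullary symbol) a positive Boolean formula $\delta(q,f)$ over $\{0,\dots,\mathrm{ar}(f)-1\}\times Q$. A tree is accepted if it has a run-tree on each of whose infinite branches the largest priority that occurs infinitely often is even. **Theorem.** Consider finitary HEPCF over any such choice of ground types, constants and operations that includes an operation $\sigma:\mathtt{Unit}\rightsquigarrow 1$. Then MSO model checking of effect trees is undecidable: no algorithm, given a computation $C$ and an APT $\mathcal A$ such that $\vdash_E C:T$ for some $E,T$ with $\Sigma_{E,T}$ finite and $\mathcal A$ is an APT over $\Sigma_{E,T}$, decides whether $\mathcal A$ accepts $ET(C)$. Moreover, this holds already for $E=\{\sigma\}$, $T=\mathtt{Unit}$ and one fixed automaton: there is an APT $\mathcal A_\bot$ over $\Sigma_{\{\sigma\},\mathtt{Unit}}$ that accepts exactly the trees that contain a $\bot$, and no algorithm, given $C$ with $\vdash_{\{\sigma\}}C:\mathtt{Unit}$, decides whether $\mathcal A_\bot$ accepts $ET(C)$. -/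

import Mathlib

/-! ### Possibly infinite ranked trees -/

/-- A ranked alphabet: tree constructors together with their arity. -/
structure RankedAlphabet where
  Sym : Type
  ar : Sym → ℕ

namespace RankedAlphabet

/-- Arity on the alphabet extended with the nullary symbol `⊥`, written `none`. -/
abbrev arBot (F : RankedAlphabet) : Option F.Sym → ℕ
  | none => 0
  | some f => F.ar f

/-- The functor `X ↦ {⊥} + ∑ f, X ^ (ar f)`. -/
abbrev functor (F : RankedAlphabet) : PFunctor := ⟨Option F.Sym, fun s => Fin (F.arBot s)⟩

/-- The trees coinductively generated by `t ::= f(t₀, …, t_{ar f - 1}) | ⊥`. -/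
abbrev Tree (F : RankedAlphabet) : Type := PFunctor.M F.functor

/-- The root symbol of a tree, `none` for `⊥`. -/
def Tree.root {F : RankedAlphabet} (t : F.Tree) : Option F.Sym := PFunctor.M.head t

/-- The `i`-th immediate subtree. -/
def Tree.child {F : RankedAlphabet} (t : F.Tree) (i : Fin (F.arBot t.root)) : F.Tree :=
  PFunctor.M.children t i

/-- The subtree at a position; `none` if the word is not a position of the tree. -/
def Tree.subtree {F : RankedAlphabet} : F.Tree → List ℕ → Option F.Tree
  | t, [] => some t
  | t, i :: α => if h : i < F.arBot t.root then Tree.subtree (t.child ⟨i, h⟩) α else none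

/-- Some position of the tree is labelled `⊥`. -/
def Tree.HasBot {F : RankedAlphabet} (t : F.Tree) : Prop :=
  ∃ α u, t.subtree α = some u ∧ u.root = none

end RankedAlphabet

/-! ### Alternating parity tree automata -/

/-- Positive Boolean formulas over `X`. -/
inductive PosBool (X : Type) : Type
  | tt : PosBool X
  | ff : PosBool X
  | atom (x : X) : PosBool X
  | and (φ ψ : PosBool X) : PosBool X
  | or (φ ψ : PosBool X) : PosBool X

namespace PosBool

/-- Satisfaction of a formula by the subset `Y`. -/
def Sat {X : Type} (Y : Set X) : PosBool X → Prop
  | tt => True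
  | ff => False
  | atom x => x ∈ Y
  | and φ ψ => Sat Y φ ∧ Sat Y ψ
  | or φ ψ => Sat Y φ ∨ Sat Y ψ

/-- Gödel number of a formula, given Gödel numbers of the atoms. -/
def code {X : Type} (c : X → ℕ) : PosBool X → ℕ
  | tt => Nat.pair 0 0
  | ff => Nat.pair 1 0
  | atom x => Nat.pair 2 (c x)
  | and φ ψ => Nat.pair 3 (Nat.pair (code c φ) (code c ψ))
  | or φ ψ => Nat.pair 4 (Nat.pair (code c φ) (code c ψ))

end PosBool

/-- An alternating parity tree automaton over the alphabet `F`, with states `0, …, numStates - 1`.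
Trees may contain `⊥`, which is read as a nullary symbol. -/
structure APT (F : RankedAlphabet) where
  numStates : ℕ
  init : Fin numStates
  δ : Fin numStates → (s : Option F.Sym) → PosBool (Fin (F.arBot s) × Fin numStates)
  Ω : Fin numStates → ℕ

namespace APT

variable {F : RankedAlphabet}

/-- A run-tree node is given by the moves (direction, new state) leading to it from the root. -/
abbrev RunNode (A : APT F) : Type := List (ℕ × Fin A.numStates)

/-- The position of the input tree visited at a run-tree node. -/
def RunNode.pos {A : APT F} (p : A.RunNode) : List ℕ := p.map Prod.fst

/-- The state at a run-tree node. -/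
def RunNode.state {A : APT F} (p : A.RunNode) : Fin A.numStates :=
  (p.getLast?.map Prod.snd).getD A.init

/-- `R` is (the set of nodes of) a run-tree of `A` over `t`: it contains the root, labelled with
the empty position and the initial state, it is closed under parents, and every node, labelled
`(α, q)`, has a child `(α · i, q')` for all `(i, q')` in some set satisfying `δ q (t α)`. -/
structure IsRunTree (A : APT F) (t : F.Tree) (R : Set A.RunNode) : Prop where
  root_mem : [] ∈ R
  parent_mem : ∀ (p : A.RunNode) (m : ℕ × Fin A.numStates), p ++ [m] ∈ R → p ∈ R
  step : ∀ p ∈ R, ∃ u, t.subtree (RunNode.pos p) = some u ∧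
    ∃ Y : Set (Fin (F.arBot u.root) × Fin A.numStates),
      (A.δ (RunNode.state p) u.root).Sat Y ∧ ∀ m ∈ Y, p ++ [((m.1 : ℕ), m.2)] ∈ R

/-- The parity condition: the largest priority occurring infinitely often is even. -/
def ParityCondition (A : APT F) (q : ℕ → Fin A.numStates) : Prop :=
  ∃ m, IsGreatest {m | ∃ᶠ k in Filter.atTop, A.Ω (q k) = m} m ∧ Even m

/-- A tree is accepted if it has a run-tree all of whose infinite branches satisfy the parity
condition. -/
def Accepts (A : APT F) (t : F.Tree) : Prop :=
  ∃ R : Set A.RunNode, A.IsRunTree t R ∧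
    ∀ w : ℕ → ℕ × Fin A.numStates, (∀ n, (List.range n).map w ∈ R) →
      A.ParityCondition fun k => (w k).2

/-- `n` is the Gödel number of a finite description of `A`: number of states, initial state, list
of priorities, and a list of all the triples (state, symbol, transition formula). There is such an
`n` only if `A` has a finite alphabet. -/
def IsCode (symCode : F.Sym → ℕ) (A : APT F) (n : ℕ) : Prop :=
  ∃ l : List (ℕ × ℕ × ℕ),
    (∀ e, e ∈ l ↔ ∃ (q : Fin A.numStates) (s : Option F.Sym), e = ((q : ℕ), Encodable.encode (s.map symCode),
      (A.δ q s).code fun m => Nat.pair m.1 m.2)) ∧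
    n = Encodable.encode (A.numStates, (A.init : ℕ), List.ofFn A.Ω, l)

end APT

/-! ### The language HEPCF -/

namespace HEPCF

/-- The parameters of the language: finitely many ground types, among them the unit type, finitely
many constants, each of a ground type, with `star` the only one of unit type, and finitely many
algebraic operations, each with a ground parameter type and an arity. -/
structure Lang where
  numGround : ℕ
  numConst : ℕ
  numOp : ℕ
  constTy : Fin numConst → Fin numGround
  unit : Fin numGround
  star : Fin numConst
  constTy_eq_unit : ∀ c, constTy c = unit ↔ c = star
  opParam : Fin numOp → Fin numGround
  opArity : Fin numOp → ℕ

abbrev Lang.Ground (S : Lang) : Type := Fin S.numGround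
abbrev Lang.Const (S : Lang) : Type := Fin S.numConst
abbrev Lang.Op (S : Lang) : Type := Fin S.numOp

/-- Types: ground types, enumeration types, and functions annotated with the effects that they may
perform. -/
inductive Ty (S : Lang) : Type
  | ground (B : S.Ground) : Ty S
  | enum (k : ℕ) : Ty S
  | arrow (T : Ty S) (E : Finset S.Op) (U : Ty S) : Ty S

mutual
/-- Values, with de Bruijn indices; `lam` and `fix` bind one variable. -/
inductive Val (S : Lang) : Type
  | const (v : S.Const) : Val S
  | num (n : ℕ) : Val S
  | var (x : ℕ) : Val S
  | lam (C : Comp S) : Val S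
  | fix (V : Val S) : Val S
/-- Computations. `op σ V C` is `σ(V; x. C)` and `letin C D` is `let x = C in D`, with `x` bound in
the last argument. `handle E ret cl C` is `handle H C` for the handler `H` with the return clause
`return(x) ↦ ret`, which binds one variable, and for each `σ ∈ E` the clause `σ(x; r) ↦ cl σ`, which
binds `x` (index `1`) and `r` (index `0`). -/
inductive Comp (S : Lang) : Type
  | app (V W : Val S) : Comp S
  | op (σ : S.Op) (V : Val S) (C : Comp S) : Comp S
  | ret (V : Val S) : Comp S
  | letin (C D : Comp S) : Comp S
  | handle (E : Finset S.Op) (ret : Comp S) (cl : {σ // σ ∈ E} → Comp S) (C : Comp S) : Comp S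
  | case (V : Val S) (k : ℕ) (Cs : Fin k → Comp S) : Comp S
end

variable {S : Lang}

/-! Renaming and simultaneous substitution. -/

/-- A renaming under one more binder. -/
def upRen (ρ : ℕ → ℕ) : ℕ → ℕ
  | 0 => 0
  | n + 1 => ρ n + 1

mutual
def Val.ren : (ℕ → ℕ) → Val S → Val S
  | _, .const v => .const v
  | _, .num n => .num n
  | ρ, .var x => .var (ρ x)
  | ρ, .lam C => .lam (C.ren (upRen ρ))
  | ρ, .fix V => .fix (V.ren (upRen ρ))
def Comp.ren : (ℕ → ℕ) → Comp S → Comp S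
  | ρ, .app V W => .app (V.ren ρ) (W.ren ρ)
  | ρ, .op σ V C => .op σ (V.ren ρ) (C.ren (upRen ρ))
  | ρ, .ret V => .ret (V.ren ρ)
  | ρ, .letin C D => .letin (C.ren ρ) (D.ren (upRen ρ))
  | ρ, .handle E r cl C =>
      .handle E (r.ren (upRen ρ)) (fun σ => (cl σ).ren (upRen (upRen ρ))) (C.ren ρ)
  | ρ, .case V k Cs => .case (V.ren ρ) k (fun i => (Cs i).ren ρ)
end

/-- Extend a substitution with a value for the variable `0`. -/
def scons (V : Val S) (s : ℕ → Val S) : ℕ → Val S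
  | 0 => V
  | n + 1 => s n

/-- A substitution under one more binder. -/
def upSubst (s : ℕ → Val S) : ℕ → Val S := scons (.var 0) fun n => (s n).ren Nat.succ

mutual
def Val.subst : (ℕ → Val S) → Val S → Val S
  | _, .const v => .const v
  | _, .num n => .num n
  | s, .var x => s x
  | s, .lam C => .lam (C.subst (upSubst s))
  | s, .fix V => .fix (V.subst (upSubst s))
def Comp.subst : (ℕ → Val S) → Comp S → Comp S
  | s, .app V W => .app (V.subst s) (W.subst s)
  | s, .op σ V C => .op σ (V.subst s) (C.subst (upSubst s))
  | s, .ret V => .ret (V.subst s)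
  | s, .letin C D => .letin (C.subst s) (D.subst (upSubst s))
  | s, .handle E r cl C =>
      .handle E (r.subst (upSubst s)) (fun σ => (cl σ).subst (upSubst (upSubst s))) (C.subst s)
  | s, .case V k Cs => .case (V.subst s) k (fun i => (Cs i).subst s)
end

/-- `V[W / x]` for the variable `x` of index `0`. -/
def Val.inst (V W : Val S) : Val S := V.subst (scons W Val.var)

/-- `C[W / x]` for the variable `x` of index `0`. -/
def Comp.inst (C : Comp S) (W : Val S) : Comp S := C.subst (scons W Val.var)

/-- `C[V / x, R / r]` for the variables `r` of index `0` and `x` of index `1`. -/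
def Comp.inst₂ (C : Comp S) (V R : Val S) : Comp S := C.subst (scons R (scons V Val.var))

/-! Static semantics. -/

mutual
/-- `Γ ⊢ V : T`. -/
inductive Val.HasTy : List (Ty S) → Val S → Ty S → Prop
  | const (Γ : List (Ty S)) (v : S.Const) : Val.HasTy Γ (.const v) (.ground (S.constTy v))
  | num (Γ : List (Ty S)) (n k : ℕ) : n < k → Val.HasTy Γ (.num n) (.enum k)
  | var (Γ : List (Ty S)) (x : ℕ) (T : Ty S) : Γ[x]? = some T → Val.HasTy Γ (.var x) T
  | lam (Γ : List (Ty S)) (C : Comp S) (T U : Ty S) (E : Finset S.Op) :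
      Comp.HasTy (T :: Γ) E C U → Val.HasTy Γ (.lam C) (.arrow T E U)
  | fix (Γ : List (Ty S)) (V : Val S) (T U : Ty S) (E : Finset S.Op) :
      Val.HasTy (.arrow T E U :: Γ) V (.arrow T E U) → Val.HasTy Γ (.fix V) (.arrow T E U)
/-- `Γ ⊢_E C : T`. -/
inductive Comp.HasTy : List (Ty S) → Finset S.Op → Comp S → Ty S → Prop
  | app (Γ : List (Ty S)) (E : Finset S.Op) (V W : Val S) (T U : Ty S) :
      Val.HasTy Γ V (.arrow T E U) → Val.HasTy Γ W T → Comp.HasTy Γ E (.app V W) U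
  | op (Γ : List (Ty S)) (E : Finset S.Op) (σ : S.Op) (V : Val S) (C : Comp S) (T : Ty S) :
      σ ∈ E → Val.HasTy Γ V (.ground (S.opParam σ)) →
      Comp.HasTy (.enum (S.opArity σ) :: Γ) E C T → Comp.HasTy Γ E (.op σ V C) T
  | ret (Γ : List (Ty S)) (E : Finset S.Op) (V : Val S) (T : Ty S) :
      Val.HasTy Γ V T → Comp.HasTy Γ E (.ret V) T
  | letin (Γ : List (Ty S)) (E : Finset S.Op) (C D : Comp S) (U T : Ty S) :
      Comp.HasTy Γ E C U → Comp.HasTy (U :: Γ) E D T → Comp.HasTy Γ E (.letin C D) T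
  | handle (Γ : List (Ty S)) (E E' : Finset S.Op) (r : Comp S) (cl : {σ // σ ∈ E'} → Comp S)
      (C : Comp S) (U T : Ty S) :
      Comp.HasTy (U :: Γ) E r T →
      (∀ σ : {σ // σ ∈ E'}, Comp.HasTy
        (.arrow (.enum (S.opArity σ)) E T :: .ground (S.opParam σ) :: Γ) E (cl σ) T) →
      Comp.HasTy Γ E' C U → Comp.HasTy Γ E (.handle E' r cl C) T
  | case (Γ : List (Ty S)) (E : Finset S.Op) (V : Val S) (k : ℕ) (Cs : Fin k → Comp S) (T : Ty S) :
      Val.HasTy Γ V (.enum k) → (∀ i, Comp.HasTy Γ E (Cs i) T) → Comp.HasTy Γ E (.case V k Cs) T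
end

/-! Dynamic semantics. -/

/-- One step of reduction. -/
inductive Step : Comp S → Comp S → Prop
  | beta (C : Comp S) (W : Val S) : Step (.app (.lam C) W) (C.inst W)
  | fix (V W : Val S) : Step (.app (.fix V) W) (.app (V.inst (.fix V)) W)
  | case (k : ℕ) (n : Fin k) (Cs : Fin k → Comp S) : Step (.case (.num n) k Cs) (Cs n)
  | letRet (V : Val S) (C : Comp S) : Step (.letin (.ret V) C) (C.inst V)
  | letStep (C C' B : Comp S) : Step C C' → Step (.letin C B) (.letin C' B)
  | letOp (σ : S.Op) (V : Val S) (C D : Comp S) :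
      Step (.letin (.op σ V C) D) (.op σ V (.letin C (D.ren (upRen Nat.succ))))
  | handleStep (E : Finset S.Op) (r : Comp S) (cl : {σ // σ ∈ E} → Comp S) (C C' : Comp S) :
      Step C C' → Step (.handle E r cl C) (.handle E r cl C')
  | handleRet (E : Finset S.Op) (r : Comp S) (cl : {σ // σ ∈ E} → Comp S) (V : Val S) :
      Step (.handle E r cl (.ret V)) (r.inst V)
  | handleOp (E : Finset S.Op) (r : Comp S) (cl : {σ // σ ∈ E} → Comp S) (σ : S.Op) (h : σ ∈ E)
      (V : Val S) (C : Comp S) :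
      Step (.handle E r cl (.op σ V C))
        ((cl ⟨σ, h⟩).inst₂ V (.lam (.handle E (r.ren (upRen Nat.succ))
          (fun τ => (cl τ).ren (upRen (upRen Nat.succ))) C)))

/-- Reduction in any number of steps. -/
abbrev Steps : Comp S → Comp S → Prop := Relation.ReflTransGen Step

/-! ### Effect trees -/

/-- The constructors of effect trees of computations of type `T` with effects in `E`. -/
inductive EffSym (S : Lang) (E : Finset S.Op) (T : Ty S) : Type
  | op (σ : {σ // σ ∈ E}) : EffSym S E T
  | ret (V : {V : Val S // Val.HasTy [] V T}) : EffSym S E T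
  | param (v : S.Const) : EffSym S E T

/-- The signature of effect trees: an operation of arity `k` has a first child for its parameter
and then `k` children for its continuations; returned values and parameters are leaves. -/
abbrev effSig (S : Lang) (E : Finset S.Op) (T : Ty S) : RankedAlphabet where
  Sym := EffSym S E T
  ar := fun
    | .op σ => S.opArity σ + 1
    | .ret _ => 0
    | .param _ => 0

open Classical in
/-- The first level of the effect tree of a computation, or of a parameter leaf. For a closed `C`
with `⊢_E C : T` every returned value has type `T` and every uncaught operation is in `E` and has
a constant parameter, so that the last case is that of divergence. -/
noncomputable def effStep (E : Finset S.Op) (T : Ty S) :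
    Comp S ⊕ S.Const → (effSig S E T).functor.Obj (Comp S ⊕ S.Const)
  | .inr v => ⟨some (EffSym.param v), fun i => Fin.elim0 i⟩
  | .inl C =>
    if h : ∃ V : {V : Val S // Val.HasTy [] V T}, Steps C (.ret V) then
      ⟨some (EffSym.ret h.choose), fun i => Fin.elim0 i⟩
    else if h : ∃ p : {σ // σ ∈ E} × S.Const × Comp S,
        Steps C (.op p.1 (.const p.2.1) p.2.2) then
      ⟨some (EffSym.op h.choose.1),
        Fin.cases (Sum.inr h.choose.2.1) fun j => Sum.inl (h.choose.2.2.inst (.num j))⟩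
    else ⟨none, fun i => Fin.elim0 i⟩

/-- The effect tree `ET(C)` of a closed computation `⊢_E C : T`. -/
noncomputable def effectTree (E : Finset S.Op) (T : Ty S) (C : Comp S) : (effSig S E T).Tree :=
  PFunctor.M.corec (effStep E T) (Sum.inl C)

/-! ### Gödel numbers -/

mutual
/-- Gödel number of a value. -/
def Val.code : Val S → ℕ
  | .const v => Nat.pair 0 v
  | .num n => Nat.pair 1 n
  | .var x => Nat.pair 2 x
  | .lam C => Nat.pair 3 C.code
  | .fix V => Nat.pair 4 V.code
/-- Gödel number of a computation. The clauses of a handler are listed by operation, with `0` for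
the operations that it does not handle. -/
def Comp.code : Comp S → ℕ
  | .app V W => Nat.pair 0 (Nat.pair V.code W.code)
  | .op σ V C => Nat.pair 1 (Nat.pair σ (Nat.pair V.code C.code))
  | .ret V => Nat.pair 2 V.code
  | .letin C D => Nat.pair 3 (Nat.pair C.code D.code)
  | .handle E r cl C => Nat.pair 4 (Nat.pair r.code (Nat.pair C.code
      (Encodable.encode (List.ofFn fun σ : Fin S.numOp =>
        if h : σ ∈ E then (cl ⟨σ, h⟩).code + 1 else 0))))
  | .case V _ Cs => Nat.pair 5 (Nat.pair V.code (Encodable.encode (List.ofFn fun i => (Cs i).code)))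
end

mutual
theorem Val.code_inj : ∀ V W : Val S, V.code = W.code → V = W
  | .const v, W, h => by
    cases W <;> simp [Val.code, Nat.pair_eq_pair, Fin.val_inj] at h ⊢
    exact h
  | .num n, W, h => by
    cases W <;> simp [Val.code, Nat.pair_eq_pair] at h ⊢
    exact h
  | .var x, W, h => by
    cases W <;> simp [Val.code, Nat.pair_eq_pair] at h ⊢
    exact h
  | .lam C, W, h => by
    cases W <;> simp [Val.code, Nat.pair_eq_pair] at h ⊢
    exact Comp.code_inj C _ h
  | .fix V, W, h => by
    cases W <;> simp [Val.code, Nat.pair_eq_pair] at h ⊢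
    exact Val.code_inj V _ h
theorem Comp.code_inj : ∀ C D : Comp S, C.code = D.code → C = D
  | .app V W, D, h => by
    cases D <;> simp [Comp.code, Nat.pair_eq_pair] at h ⊢
    exact ⟨Val.code_inj V _ h.1, Val.code_inj W _ h.2⟩
  | .op σ V C, D, h => by
    cases D <;> simp [Comp.code, Nat.pair_eq_pair, Fin.val_inj] at h ⊢
    exact ⟨h.1, Val.code_inj V _ h.2.1, Comp.code_inj C _ h.2.2⟩
  | .ret V, D, h => by
    cases D <;> simp [Comp.code, Nat.pair_eq_pair] at h ⊢
    exact Val.code_inj V _ h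
  | .letin C B, D, h => by
    cases D <;> simp [Comp.code, Nat.pair_eq_pair] at h ⊢
    exact ⟨Comp.code_inj C _ h.1, Comp.code_inj B _ h.2⟩
  | .handle E r cl C, D, h => by
    cases D with
    | handle E' r' cl' C' =>
      simp only [Comp.code, Nat.pair_eq_pair, Encodable.encode_inj, List.ofFn_inj, true_and] at h
      obtain ⟨h1, h2, h3⟩ := h
      have hE : E = E' := by
        ext σ
        have := congrFun h3 σ
        by_cases h : σ ∈ E <;> by_cases h' : σ ∈ E' <;> simp [h, h'] at this ⊢
      subst hE
      have hcl : cl = cl' := by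
        funext σ
        have := congrFun h3 σ.1
        simp only [σ.2, dite_true, Nat.add_right_cancel_iff] at this
        exact Comp.code_inj (cl σ) _ this
      rw [Comp.code_inj r _ h1, Comp.code_inj C _ h2, hcl]
    | _ => simp [Comp.code, Nat.pair_eq_pair] at h
  | .case V k Cs, D, h => by
    cases D with
    | case V' k' Cs' =>
      simp only [Comp.code, Nat.pair_eq_pair, Encodable.encode_inj, true_and] at h
      obtain ⟨h1, h2⟩ := h
      have hk : k = k' := by simpa using congrArg List.length h2
      subst hk
      have hC : Cs = Cs' := by
        funext i
        exact Comp.code_inj (Cs i) _ (congrFun (List.ofFn_inj.1 h2) i)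
      rw [Val.code_inj V _ h1, hC]
    | _ => simp [Comp.code, Nat.pair_eq_pair] at h
end

/-- Gödel number of a constructor of effect trees. -/
def EffSym.code {E : Finset S.Op} {T : Ty S} : EffSym S E T → ℕ
  | .op σ => Nat.pair 0 (σ : S.Op)
  | .ret V => Nat.pair 1 V.1.code
  | .param v => Nat.pair 2 v

/-! ### The model-checking problem -/

/-- A problem with instances `x : α`, given by Gödel numbers `n` with `codes x n`, is decidable: an
algorithm halts on all Gödel numbers of instances and answers correctly there. Nothing is asked on
other inputs. -/
def AlgDecidable {α : Type} (codes : α → ℕ → Prop) (P : α → Prop) : Prop :=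
  ∃ f : ℕ →. Bool, Partrec f ∧ ∀ x n, codes x n → ∃ b ∈ f n, (b = true ↔ P x)

/-- An instance of the model-checking problem: a closed computation `⊢_E C : T` and an alternating
parity tree automaton over the signature of its effect tree. -/
structure MCInstance (S : Lang) where
  E : Finset S.Op
  T : Ty S
  C : Comp S
  typed : Comp.HasTy [] E C T
  A : APT (effSig S E T)

/-- Gödel numbers of instances; there are some only if the signature of the effect tree is finite,
as it is when `T` is a ground type. -/
def MCInstance.IsCode (I : MCInstance S) (n : ℕ) : Prop :=
  ∃ a, I.A.IsCode EffSym.code a ∧ n = Nat.pair I.C.code a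

/-- MSO model checking of effect trees is decidable: given `C` and `A`, does `A` accept the effect
tree of `C`? -/
def MSODecidable (S : Lang) : Prop :=
  AlgDecidable (α := MCInstance S) MCInstance.IsCode fun I =>
    I.A.Accepts (effectTree I.E I.T I.C)

end HEPCF

/-!
The halting problem reduces to deciding whether an effect tree contains `⊥`.

A natural number `n` is represented by a thunk that performs the unary operation `σ` exactly `n`
times and then returns. Although all data types of the language are finite, a deep handler can
inspect such a thunk: a handler that ignores the resumption tests for zero (`ifz`), and a handler
whose result is a function on `{0, 1}` computes the predecessor (`predH`), because the resumption
can be run in a mode that differs from the one in which the first operation is treated. Finite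
lists of numbers are represented by functions from indices to entries, with `0` beyond the end of
the list; `consV`, `headV` and `tailV` work on them with the zero test, successor and predecessor
of the index.

With general recursion this is enough to compile Mathlib's basis `Turing.ToPartrec.Code` of the
partial recursive functions on lists, in which an absent entry counts as `0` as well (`compile`).
The compiled code returns a representation of the result where the code is defined
(`RepList.compile_of_mem_eval`) and terminates nowhere else (`RepList.dom_of_terminates`).

For a code `c` with undecidable domain, `haltComp σ c n` runs the compiled code on the list `[n]`
and returns `()`. No operation escapes from it, so its effect tree is a returned value if `c` is
defined at `[n]`, and is `⊥` otherwise (`hasBot_haltComp_iff`). Since only the numeral depends on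
`n`, its Gödel number is computable in `n`.

The trees that contain `⊥` are accepted by an automaton with one state of odd priority, which moves
to some child until it reaches `⊥` (`APT.botSearch`). Over a finite alphabet this automaton has a
Gödel number, so that the uniform model-checking problem is undecidable too.
-/

namespace HEPCF
variable {S : Lang}

/-! ### Renaming and substitution -/

@[simp] theorem upSubst_var : upSubst (S := S) Val.var = Val.var := by
  funext n; cases n <;> rfl

@[simp] theorem upSubst_zero (s : ℕ → Val S) : upSubst s 0 = .var 0 := rfl

@[simp] theorem upSubst_succ (s : ℕ → Val S) (n : ℕ) :
    upSubst s (n + 1) = (s n).ren Nat.succ := rfl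

@[simp] theorem scons_zero (V : Val S) (s : ℕ → Val S) : scons V s 0 = V := rfl

@[simp] theorem upRen_zero (ρ : ℕ → ℕ) : upRen ρ 0 = 0 := rfl

@[simp] theorem upRen_succ (ρ : ℕ → ℕ) (n : ℕ) : upRen ρ (n + 1) = ρ n + 1 := rfl

theorem upRen_comp (ρ ρ' : ℕ → ℕ) : upRen ρ' ∘ upRen ρ = upRen (ρ' ∘ ρ) := by
  funext n; cases n <;> rfl

theorem upSubst_comp_upRen (s : ℕ → Val S) (ρ : ℕ → ℕ) :
    upSubst s ∘ upRen ρ = upSubst (s ∘ ρ) := by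
  funext n; cases n <;> rfl

mutual
theorem Val.subst_var : ∀ V : Val S, V.subst Val.var = V
  | .const _ | .num _ | .var _ => rfl
  | .lam C => by simp [Val.subst, Comp.subst_var C]
  | .fix V => by simp [Val.subst, Val.subst_var V]
theorem Comp.subst_var : ∀ C : Comp S, C.subst Val.var = C
  | .app V W => by simp [Comp.subst, Val.subst_var V, Val.subst_var W]
  | .op σ V C => by simp [Comp.subst, Val.subst_var V, Comp.subst_var C]
  | .ret V => by simp [Comp.subst, Val.subst_var V]
  | .letin C D => by simp [Comp.subst, Comp.subst_var C, Comp.subst_var D]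
  | .handle E r cl C => by
    simp [Comp.subst, Comp.subst_var C, Comp.subst_var r, fun τ => Comp.subst_var (cl τ)]
  | .case V k Cs => by simp [Comp.subst, Val.subst_var V, fun i => Comp.subst_var (Cs i)]
end

mutual
theorem Val.ren_ren : ∀ (V : Val S) (ρ ρ' : ℕ → ℕ), (V.ren ρ).ren ρ' = V.ren (ρ' ∘ ρ)
  | .const _, _, _ | .num _, _, _ | .var _, _, _ => rfl
  | .lam C, ρ, ρ' => by simp [Val.ren, Comp.ren_ren C, upRen_comp]
  | .fix V, ρ, ρ' => by simp [Val.ren, Val.ren_ren V, upRen_comp]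
theorem Comp.ren_ren : ∀ (C : Comp S) (ρ ρ' : ℕ → ℕ), (C.ren ρ).ren ρ' = C.ren (ρ' ∘ ρ)
  | .app V W, ρ, ρ' => by simp [Comp.ren, Val.ren_ren V, Val.ren_ren W]
  | .op σ V C, ρ, ρ' => by simp [Comp.ren, Val.ren_ren V, Comp.ren_ren C, upRen_comp]
  | .ret V, ρ, ρ' => by simp [Comp.ren, Val.ren_ren V]
  | .letin C D, ρ, ρ' => by simp [Comp.ren, Comp.ren_ren C, Comp.ren_ren D, upRen_comp]
  | .handle E r cl C, ρ, ρ' => by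
    simp [Comp.ren, Comp.ren_ren C, Comp.ren_ren r, fun τ => Comp.ren_ren (cl τ), upRen_comp]
  | .case V k Cs, ρ, ρ' => by
    simp [Comp.ren, Val.ren_ren V, fun i => Comp.ren_ren (Cs i)]
end

mutual
theorem Val.subst_ren : ∀ (V : Val S) (ρ : ℕ → ℕ) (s : ℕ → Val S),
    (V.ren ρ).subst s = V.subst (s ∘ ρ)
  | .const _, _, _ | .num _, _, _ | .var _, _, _ => rfl
  | .lam C, ρ, s => by simp [Val.ren, Val.subst, Comp.subst_ren C, upSubst_comp_upRen]
  | .fix V, ρ, s => by simp [Val.ren, Val.subst, Val.subst_ren V, upSubst_comp_upRen]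
theorem Comp.subst_ren : ∀ (C : Comp S) (ρ : ℕ → ℕ) (s : ℕ → Val S),
    (C.ren ρ).subst s = C.subst (s ∘ ρ)
  | .app V W, ρ, s => by simp [Comp.ren, Comp.subst, Val.subst_ren V, Val.subst_ren W]
  | .op σ V C, ρ, s => by
    simp [Comp.ren, Comp.subst, Val.subst_ren V, Comp.subst_ren C, upSubst_comp_upRen]
  | .ret V, ρ, s => by simp [Comp.ren, Comp.subst, Val.subst_ren V]
  | .letin C D, ρ, s => by
    simp [Comp.ren, Comp.subst, Comp.subst_ren C, Comp.subst_ren D, upSubst_comp_upRen]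
  | .handle E r cl C, ρ, s => by
    simp [Comp.ren, Comp.subst, Comp.subst_ren C, Comp.subst_ren r,
      fun τ => Comp.subst_ren (cl τ), upSubst_comp_upRen]
  | .case V k Cs, ρ, s => by
    simp [Comp.ren, Comp.subst, Val.subst_ren V, fun i => Comp.subst_ren (Cs i)]
end

theorem upSubst_ren (s : ℕ → Val S) (ρ : ℕ → ℕ) :
    (fun n => (upSubst s n).ren (upRen ρ)) = upSubst fun n => (s n).ren ρ := by
  funext n
  cases n with
  | zero => rfl
  | succ n => simp only [upSubst_succ, Val.ren_ren]; rfl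

mutual
theorem Val.ren_subst : ∀ (V : Val S) (s : ℕ → Val S) (ρ : ℕ → ℕ),
    (V.subst s).ren ρ = V.subst fun n => (s n).ren ρ
  | .const _, _, _ | .num _, _, _ | .var _, _, _ => rfl
  | .lam C, s, ρ => by simp [Val.ren, Val.subst, Comp.ren_subst C, upSubst_ren]
  | .fix V, s, ρ => by simp [Val.ren, Val.subst, Val.ren_subst V, upSubst_ren]
theorem Comp.ren_subst : ∀ (C : Comp S) (s : ℕ → Val S) (ρ : ℕ → ℕ),
    (C.subst s).ren ρ = C.subst fun n => (s n).ren ρ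
  | .app V W, s, ρ => by simp [Comp.ren, Comp.subst, Val.ren_subst V, Val.ren_subst W]
  | .op σ V C, s, ρ => by
    simp [Comp.ren, Comp.subst, Val.ren_subst V, Comp.ren_subst C, upSubst_ren]
  | .ret V, s, ρ => by simp [Comp.ren, Comp.subst, Val.ren_subst V]
  | .letin C D, s, ρ => by
    simp [Comp.ren, Comp.subst, Comp.ren_subst C, Comp.ren_subst D, upSubst_ren]
  | .handle E r cl C, s, ρ => by
    simp [Comp.ren, Comp.subst, Comp.ren_subst C, Comp.ren_subst r,
      fun τ => Comp.ren_subst (cl τ), upSubst_ren]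
  | .case V k Cs, s, ρ => by
    simp [Comp.ren, Comp.subst, Val.ren_subst V, fun i => Comp.ren_subst (Cs i)]
end

/-- Substitution commutes with weakening. -/
theorem Val.subst_shift (V : Val S) (s : ℕ → Val S) :
    (V.ren Nat.succ).subst (upSubst s) = (V.subst s).ren Nat.succ := by
  rw [Val.subst_ren, Val.ren_subst]; rfl

theorem Comp.subst_shift (C : Comp S) (s : ℕ → Val S) :
    (C.ren Nat.succ).subst (upSubst s) = (C.subst s).ren Nat.succ := by
  rw [Comp.subst_ren, Comp.ren_subst]; rfl

/-- Substituting for the freshly introduced variable undoes weakening. -/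
theorem Val.subst_scons_shift (V W : Val S) : (V.ren Nat.succ).subst (scons W Val.var) = V := by
  rw [Val.subst_ren]; exact Val.subst_var V

theorem Comp.subst_scons_shift (C : Comp S) (W : Val S) :
    (C.ren Nat.succ).subst (scons W Val.var) = C := by
  rw [Comp.subst_ren]; exact Comp.subst_var C

theorem Val.ren_eq_subst (V : Val S) (ρ : ℕ → ℕ) : V.ren ρ = V.subst fun n => .var (ρ n) := by
  rw [← Val.subst_var (V.ren ρ), Val.subst_ren]; rfl

theorem Comp.ren_eq_subst (C : Comp S) (ρ : ℕ → ℕ) : C.ren ρ = C.subst fun n => .var (ρ n) := by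
  rw [← Comp.subst_var (C.ren ρ), Comp.subst_ren]; rfl

theorem getElem?_upRen {Γ Δ : List (Ty S)} {ρ : ℕ → ℕ}
    (h : ∀ x U, Γ[x]? = some U → Δ[ρ x]? = some U) (T : Ty S) :
    ∀ x U, (T :: Γ)[x]? = some U → (T :: Δ)[upRen ρ x]? = some U
  | 0, _, hx => by simpa using hx
  | x + 1, U, hx => by simpa using h x U (by simpa using hx)

mutual
theorem Val.HasTy.ren : ∀ {Γ : List (Ty S)} {V : Val S} {T : Ty S}, Val.HasTy Γ V T →
    ∀ {Δ : List (Ty S)} {ρ : ℕ → ℕ}, (∀ x U, Γ[x]? = some U → Δ[ρ x]? = some U) →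
      Val.HasTy Δ (V.ren ρ) T
  | _, _, _, .const _ v, _, _, _ => .const _ v
  | _, _, _, .num _ n k h, _, _, _ => .num _ n k h
  | _, _, _, .var _ x T h, _, _, hρ => .var _ _ _ (hρ _ _ h)
  | _, _, _, .lam _ C T U E h, _, _, hρ => .lam _ _ _ _ _ (h.ren (getElem?_upRen hρ _))
  | _, _, _, .fix _ V T U E h, _, _, hρ => .fix _ _ _ _ _ (h.ren (getElem?_upRen hρ _))
theorem Comp.HasTy.ren : ∀ {Γ : List (Ty S)} {E : Finset S.Op} {C : Comp S} {T : Ty S},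
    Comp.HasTy Γ E C T →
    ∀ {Δ : List (Ty S)} {ρ : ℕ → ℕ}, (∀ x U, Γ[x]? = some U → Δ[ρ x]? = some U) →
      Comp.HasTy Δ E (C.ren ρ) T
  | _, _, _, _, .app _ _ _ _ _ _ h h', _, _, hρ => .app _ _ _ _ _ _ (h.ren hρ) (h'.ren hρ)
  | _, _, _, _, .op _ _ _ _ _ _ hσ h h', _, _, hρ =>
      .op _ _ _ _ _ _ hσ (h.ren hρ) (h'.ren (getElem?_upRen hρ _))
  | _, _, _, _, .ret _ _ _ _ h, _, _, hρ => .ret _ _ _ _ (h.ren hρ)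
  | _, _, _, _, .letin _ _ _ _ _ _ h h', _, _, hρ =>
      .letin _ _ _ _ _ _ (h.ren hρ) (h'.ren (getElem?_upRen hρ _))
  | _, _, _, _, .handle _ _ _ _ _ _ _ _ h h' h'', _, _, hρ =>
      .handle _ _ _ _ _ _ _ _ (h.ren (getElem?_upRen hρ _))
        (fun τ => (h' τ).ren (getElem?_upRen (getElem?_upRen hρ _) _)) (h''.ren hρ)
  | _, _, _, _, .case _ _ _ _ _ _ h h', _, _, hρ =>
      .case _ _ _ _ _ _ (h.ren hρ) fun i => (h' i).ren hρ
end

theorem Val.HasTy.shift {Γ : List (Ty S)} {V : Val S} {T : Ty S} (h : Val.HasTy Γ V T)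
    (U : Ty S) : Val.HasTy (U :: Γ) (V.ren Nat.succ) T :=
  h.ren fun _ _ hx => by simpa using hx

theorem Comp.HasTy.shift {Γ : List (Ty S)} {E : Finset S.Op} {C : Comp S} {T : Ty S}
    (h : Comp.HasTy Γ E C T) (U : Ty S) : Comp.HasTy (U :: Γ) E (C.ren Nat.succ) T :=
  h.ren fun _ _ hx => by simpa using hx

/-! ### Determinism and termination -/

/-- Inversion for `case`, with the index as a natural number so that its bound need not be matched. -/
theorem Step.of_case {n k : ℕ} {Cs : Fin k → Comp S} {D : Comp S}
    (h : Step (.case (.num n) k Cs) D) : ∃ hn : n < k, D = Cs ⟨n, hn⟩ := by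
  generalize hC : Comp.case (.num n) k Cs = C at h
  cases h <;> cases hC
  exact ⟨Fin.isLt _, rfl⟩

theorem Step.deterministic {C D D' : Comp S} (h : Step C D) (h' : Step C D') : D = D' := by
  induction h generalizing D' with
  | case => obtain ⟨_, rfl⟩ := h'.of_case; rfl
  | beta | fix => cases h'; rfl
  | letRet | letOp =>
    cases h' with
    | letStep _ _ _ h => cases h
    | _ => rfl
  | handleRet | handleOp =>
    cases h' with
    | handleStep _ _ _ _ _ h => cases h
    | _ => rfl
  | letStep C C' B h ih =>
    cases h' with
    | letStep _ _ _ h' => rw [ih h']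
    | _ => cases h
  | handleStep E r cl C C' h ih =>
    cases h' with
    | handleStep _ _ _ _ _ h' => rw [ih h']
    | _ => cases h

/-- Every reduction sequence from `C` is finite. -/
def Comp.Terminates (C : Comp S) : Prop := Acc (fun D C => Step C D) C

theorem Comp.Terminates.steps {C D : Comp S} (h : C.Terminates) (hs : Steps C D) :
    D.Terminates := by
  induction hs with
  | refl => exact h
  | tail _ hs ih => exact ih.inv hs

theorem Comp.terminates_of_normal {C : Comp S} (h : ∀ D, ¬ Step C D) : C.Terminates :=
  ⟨_, fun D hD => absurd hD (h D)⟩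

/-- Since reduction is deterministic, reaching a normal form excludes infinite reductions. -/
theorem Comp.terminates_of_steps_normal {C D : Comp S} (hs : Steps C D) (h : ∀ D', ¬ Step D D') :
    C.Terminates := by
  induction hs using Relation.ReflTransGen.head_induction_on with
  | refl => exact terminates_of_normal h
  | head hs _ ih => exact ⟨_, fun D' hD' => hs.deterministic hD' ▸ ih⟩

theorem Comp.Terminates.of_letin {C D : Comp S} (h : (Comp.letin C D).Terminates) :
    C.Terminates := by
  generalize hB : Comp.letin C D = B at h
  induction h generalizing C with
  | intro B _ ih =>
    subst hB
    exact ⟨_, fun C' hC' => ih _ (.letStep _ _ _ hC') rfl⟩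

theorem Steps.letin {C C' : Comp S} (h : Steps C C') (D : Comp S) :
    Steps (.letin C D) (.letin C' D) :=
  h.lift (fun C => Comp.letin C D) fun _ _ => .letStep _ _ _

theorem Steps.letin_ret {C : Comp S} {V : Val S} (h : Steps C (.ret V)) (D : Comp S) :
    Steps (.letin C D) (D.inst V) :=
  (h.letin D).tail (.letRet _ _)

theorem Steps.handle {C C' : Comp S} (h : Steps C C') {E : Finset S.Op} (r : Comp S)
    (cl : {σ // σ ∈ E} → Comp S) : Steps (.handle E r cl C) (.handle E r cl C') :=
  h.lift (fun C => Comp.handle E r cl C) fun _ _ => .handleStep _ _ _ _ _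

/-! ### Numbers as effects -/

/-- The constant `()`. -/
abbrev Lang.starV (S : Lang) : Val S := .const S.star

/-- `C` performs the operation `σ` exactly `n` times and then returns `()`. -/
inductive Emits (σ : S.Op) : Comp S → ℕ → Prop
  | zero {C : Comp S} : Steps C (.ret S.starV) → Emits σ C 0
  | succ {C D : Comp S} {n : ℕ} :
      Steps C (.op σ S.starV D) → Emits σ (D.inst (.num 0)) n → Emits σ C (n + 1)

variable {σ : S.Op}

theorem Emits.of_steps {C D : Comp S} {n : ℕ} (h : Steps C D) (hD : Emits σ D n) :
    Emits σ C n := by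
  cases hD with
  | zero h' => exact .zero (h.trans h')
  | succ h' h'' => exact .succ (h.trans h') h''

variable (σ) in
/-- A number `n` is represented by a thunk that performs `σ` exactly `n` times. -/
def RepNat (a : Val S) (n : ℕ) : Prop := Emits σ (.app a (.num 0)) n

variable (σ) in
/-- A list of numbers is represented by a function that, applied to (a representation of) an index,
performs `σ` as often as the entry at that index says, and not at all beyond the end of the list.
Trailing zeros are thus not represented faithfully, which does no harm since the operations of
`Turing.ToPartrec.Code` do not distinguish an absent entry from `0`. -/
def RepList (l : Val S) (v : List ℕ) : Prop :=
  ∀ a n, RepNat σ a n → Emits σ (.app l a) (v.getD n 0)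

/-! ### Program combinators -/

/-- Case distinction between two computations. -/
def case₂ (V : Val S) (C₀ C₁ : Comp S) : Comp S := .case V 2 fun i => if i = 0 then C₀ else C₁

theorem case₂_subst (V : Val S) (C₀ C₁ : Comp S) (s : ℕ → Val S) :
    (case₂ V C₀ C₁).subst s = case₂ (V.subst s) (C₀.subst s) (C₁.subst s) := by
  simp only [case₂, Comp.subst, Comp.case.injEq, heq_eq_eq, true_and]
  funext i; split <;> rfl

theorem steps_case₂_zero (C₀ C₁ : Comp S) : Steps (case₂ (.num 0) C₀ C₁) C₀ :=
  .single (Step.case 2 0 _)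

theorem steps_case₂_one (C₀ C₁ : Comp S) : Steps (case₂ (.num 1) C₀ C₁) C₁ :=
  .single (Step.case 2 1 _)

variable (σ)

/-- Run `D₀` if `C` returns, and `D₁` if it performs `σ`, discarding the rest of `C`. -/
def ifz (C D₀ D₁ : Comp S) : Comp S :=
  .letin (.handle {σ} (.ret (.num 0)) (fun _ => .ret (.num 1)) C)
    (case₂ (.var 0) (D₀.ren Nat.succ) (D₁.ren Nat.succ))

variable (S) in
/-- The number `0`. -/
def zeroV : Val S := .lam (.ret S.starV)

/-- The successor of a number. -/
def succV (a : Val S) : Val S :=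
  .lam (.op σ S.starV (.app ((a.ren Nat.succ).ren Nat.succ) (.num 0)))

variable (S) in
/-- The result of the handler `predH` on a computation that returns. -/
def predBase : Val S := .lam (.ret S.starV)

/-- The result of the handler `predH` on a computation that performs `σ` and has the resumption
`R`: at `0`, the rest of the computation is run, at `1`, all of it. -/
def predStep (R : Val S) : Val S :=
  .lam (case₂ (.var 0)
    (.letin (.app (R.ren Nat.succ) (.num 0)) (.app (.var 0) (.num 1)))
    (.op σ S.starV (.letin (.app ((R.ren Nat.succ).ren Nat.succ) (.num 0))
      (.app (.var 0) (.num 1)))))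

/-- A deep handler that turns `C` into a function on `{0, 1}`: at `1` it runs like `C`, and at `0`
like `C` without its first operation. -/
def predH (C : Comp S) : Comp S :=
  .handle {σ} (.ret (predBase S)) (fun _ => .ret (predStep σ (.var 0))) C

/-- The predecessor of a number. -/
def predV (a : Val S) : Val S :=
  .lam (.letin (predH σ (.app (a.ren Nat.succ) (.num 0))) (.app (.var 0) (.num 0)))

variable (S) in
/-- The empty list. -/
def nilV : Val S := .lam (.ret S.starV)

/-- The first entry of a list. -/
def headV (l : Val S) : Val S := .lam (.app (l.ren Nat.succ) (zeroV S))

/-- The list without its first entry. -/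
def tailV (l : Val S) : Val S := .lam (.app (l.ren Nat.succ) (succV σ (.var 0)))

/-- The list with first entry `a` and tail `l`. -/
def consV (a l : Val S) : Val S :=
  .lam (ifz σ (.app (.var 0) (.num 0)) (.app (a.ren Nat.succ) (.num 0))
    (.app (l.ren Nat.succ) (predV σ (.var 0))))

section subst
variable (s : ℕ → Val S)

theorem ifz_subst (C D₀ D₁ : Comp S) :
    (ifz σ C D₀ D₁).subst s = ifz σ (C.subst s) (D₀.subst s) (D₁.subst s) := by
  simp [ifz, Comp.subst, Val.subst, case₂_subst, Comp.subst_shift]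

theorem zeroV_subst : (zeroV S).subst s = zeroV S := rfl

theorem succV_subst (a : Val S) : (succV σ a).subst s = succV σ (a.subst s) := by
  simp [succV, Val.subst, Comp.subst, Val.subst_shift]

theorem predStep_subst (R : Val S) : (predStep σ R).subst s = predStep σ (R.subst s) := by
  simp [predStep, Val.subst, Comp.subst, case₂_subst, Val.subst_shift]

theorem predH_subst (C : Comp S) : (predH σ C).subst s = predH σ (C.subst s) := by
  simp [predH, Val.subst, Comp.subst, predStep_subst, predBase]

theorem predV_subst (a : Val S) : (predV σ a).subst s = predV σ (a.subst s) := by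
  simp [predV, Val.subst, Comp.subst, predH_subst, Val.subst_shift]

theorem nilV_subst : (nilV S).subst s = nilV S := rfl

theorem headV_subst (l : Val S) : (headV l).subst s = headV (l.subst s) := by
  simp [headV, Val.subst, Comp.subst, zeroV_subst, Val.subst_shift]

theorem tailV_subst (l : Val S) : (tailV σ l).subst s = tailV σ (l.subst s) := by
  simp [tailV, Val.subst, Comp.subst, succV_subst, Val.subst_shift]

theorem consV_subst (a l : Val S) :
    (consV σ a l).subst s = consV σ (a.subst s) (l.subst s) := by
  simp [consV, Val.subst, Comp.subst, ifz_subst, predV_subst, Val.subst_shift]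

end subst

variable {σ}

theorem steps_ifz_zero {C : Comp S} (h : Emits σ C 0) (D₀ D₁ : Comp S) :
    Steps (ifz σ C D₀ D₁) D₀ := by
  cases h with
  | zero h =>
    have h' := (h.handle (E := {σ}) (.ret (.num 0)) fun _ => .ret (.num 1)).tail (.handleRet _ _ _ _)
    refine (Steps.letin_ret h' _).trans ?_
    simpa [Comp.inst, case₂_subst, Val.subst, Comp.subst_scons_shift] using steps_case₂_zero D₀ D₁

theorem steps_ifz_succ {C : Comp S} {n : ℕ} (h : Emits σ C (n + 1)) (D₀ D₁ : Comp S) :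
    Steps (ifz σ C D₀ D₁) D₁ := by
  cases h with
  | succ h =>
    have h' := (h.handle (E := {σ}) (.ret (.num 0)) fun _ => .ret (.num 1)).tail
      (.handleOp _ _ _ _ (Finset.mem_singleton_self σ) _ _)
    refine (Steps.letin_ret h' _).trans ?_
    simpa [Comp.inst, case₂_subst, Val.subst, Comp.subst_scons_shift] using steps_case₂_one D₀ D₁

theorem repNat_zeroV : RepNat σ (zeroV S) 0 := .zero (.single (.beta _ _))

theorem steps_succV (a W : Val S) :
    Steps (.app (succV σ a) W) (.op σ S.starV (.app (a.ren Nat.succ) (.num 0))) := by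
  have := Step.beta (.op σ S.starV (.app ((a.ren Nat.succ).ren Nat.succ) (.num 0))) W
  simp only [Comp.inst, Comp.subst, Val.subst, Val.subst_shift, Val.subst_scons_shift] at this
  exact .single this

theorem RepNat.succ {a : Val S} {n : ℕ} (h : RepNat σ a n) : RepNat σ (succV σ a) (n + 1) := by
  refine Emits.succ (steps_succV _ _) ?_
  simp only [Comp.inst, Comp.subst, Val.subst, Val.subst_scons_shift]
  exact h

theorem steps_predH_op (D : Comp S) :
    Steps (predH σ (.op σ S.starV D)) (.ret (predStep σ (.lam (predH σ D)))) := by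
  have := Step.handleOp {σ} (.ret (predBase S)) (fun _ => .ret (predStep σ (.var 0))) σ
    (Finset.mem_singleton_self σ) S.starV D
  simp only [Comp.inst₂, Comp.subst, predStep_subst, Val.subst, Comp.ren_eq_subst, scons_zero,
    upRen_zero] at this
  exact .single this

/-- On a computation that performs `σ` exactly `n` times, the handler `predH` returns a function
that performs it `n - 1` times at `0` and `n` times at `1`. The second half is what the induction
needs: in either mode, the rest of the computation is run at `1`. -/
theorem Emits.steps_predH {C : Comp S} {n : ℕ} (h : Emits σ C n) :
    ∃ W, Steps (predH σ C) (.ret W) ∧ Emits σ (.app W (.num 0)) (n - 1) ∧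
      Emits σ (.app W (.num 1)) n := by
  induction h with
  | zero h =>
    refine ⟨predBase S, (h.handle _ _).tail (.handleRet _ _ _ _), ?_, ?_⟩ <;>
      exact .zero (.single (.beta _ _))
  | @succ C D n h _ ih =>
    obtain ⟨W, hW, -, hW'⟩ := ih
    set R : Val S := .lam (predH σ D) with hR
    have hRW : Emits σ (.letin (.app R (.num 0)) (.app (.var 0) (.num 1))) n := by
      refine .of_steps ((Steps.letin (.single (.beta _ _)) _).trans ?_) hW'
      rw [Comp.inst, predH_subst]
      exact Steps.letin_ret hW _
    have key (i : ℕ) := Step.beta (case₂ (.var 0)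
      (.letin (.app (R.ren Nat.succ) (.num 0)) (.app (.var 0) (.num 1)))
      (.op σ S.starV (.letin (.app ((R.ren Nat.succ).ren Nat.succ) (.num 0))
        (.app (.var 0) (.num 1))))) (.num i)
    simp only [Comp.inst, case₂_subst, Comp.subst, Val.subst, Val.subst_shift,
      Val.subst_scons_shift, upSubst_zero, scons_zero] at key
    refine ⟨predStep σ R, (h.handle _ _).trans (steps_predH_op D), ?_, ?_⟩
    · exact .of_steps (.head (key 0) (steps_case₂_zero _ _)) hRW
    · refine .succ (.head (key 1) (steps_case₂_one _ _)) ?_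
      simpa only [Comp.inst, Comp.subst, Val.subst, Val.subst_scons_shift, upSubst_zero] using hRW

theorem RepNat.pred {a : Val S} {n : ℕ} (h : RepNat σ a n) : RepNat σ (predV σ a) (n - 1) := by
  obtain ⟨W, hW, hW', -⟩ := Emits.steps_predH h
  have hb := Step.beta (.letin (predH σ (.app (a.ren Nat.succ) (.num 0))) (.app (.var 0) (.num 0)))
    (.num 0)
  simp only [Comp.inst, Comp.subst, predH_subst, Val.subst, Val.subst_scons_shift,
    upSubst_zero] at hb
  exact .of_steps (.head hb (Steps.letin_ret hW _)) hW'

theorem repList_nilV : RepList σ (nilV S) [] := fun _ _ _ => by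
  simpa using Emits.zero (.single (.beta _ _))

theorem RepList.head {l : Val S} {v : List ℕ} (h : RepList σ l v) :
    RepNat σ (headV l) v.headI := by
  have hb := Step.beta (.app (l.ren Nat.succ) (zeroV S)) (.num 0)
  simp only [Comp.inst, Comp.subst, Val.subst_scons_shift, zeroV_subst] at hb
  have := h _ _ repNat_zeroV
  refine .of_steps (.single hb) ?_
  cases v <;> simpa using this

theorem RepList.ifz_zero {l : Val S} {v : List ℕ} (h : RepList σ l v) (hv : v.headI = 0)
    (D₀ D₁ : Comp S) : Steps (ifz σ (.app (headV l) (.num 0)) D₀ D₁) D₀ :=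
  steps_ifz_zero (show RepNat σ (headV l) 0 from hv ▸ h.head) _ _

theorem RepList.ifz_succ {l : Val S} {v : List ℕ} {n : ℕ} (h : RepList σ l v)
    (hv : v.headI = n + 1) (D₀ D₁ : Comp S) :
    Steps (ifz σ (.app (headV l) (.num 0)) D₀ D₁) D₁ :=
  steps_ifz_succ (show RepNat σ (headV l) (n + 1) from hv ▸ h.head) _ _

theorem RepList.tail {l : Val S} {v : List ℕ} (h : RepList σ l v) :
    RepList σ (tailV σ l) v.tail := fun a n ha => by
  have hb := Step.beta (.app (l.ren Nat.succ) (succV σ (.var 0))) a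
  simp only [Comp.inst, Comp.subst, Val.subst_scons_shift, succV_subst, Val.subst,
    scons_zero] at hb
  have := h _ _ ha.succ
  refine .of_steps (.single hb) ?_
  cases v <;> simpa using this

theorem RepList.cons {a l : Val S} {n : ℕ} {v : List ℕ} (hl : RepList σ l v)
    (ha : RepNat σ a n) : RepList σ (consV σ a l) (n :: v) := fun b m hb => by
  have hs := Step.beta (ifz σ (.app (.var 0) (.num 0)) (.app (a.ren Nat.succ) (.num 0))
    (.app (l.ren Nat.succ) (predV σ (.var 0)))) b
  simp only [Comp.inst, ifz_subst, Comp.subst, Val.subst_scons_shift, predV_subst, Val.subst,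
    scons_zero] at hs
  cases m with
  | zero => exact .of_steps (.head hs (steps_ifz_zero hb _ _)) ha
  | succ m => exact .of_steps (.head hs (steps_ifz_succ hb _ _)) (hl _ _ hb.pred)

/-! ### Compiling recursive functions -/

open Turing.ToPartrec (Code)

/-- Compilation of the codes of partial recursive functions on lists to closed functions from lists
to lists. In `cons`, the variable `1` is the argument under one `let` and the result of the first
`let` under two; in `fix`, the variable `2` is the recursively defined function itself. -/
def compile (σ : S.Op) : Code → Val S
  | .zero' => .lam (.ret (consV σ (zeroV S) (.var 0)))
  | .succ => .lam (.ret (consV σ (succV σ (headV (.var 0))) (nilV S)))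
  | .tail => .lam (.ret (tailV σ (.var 0)))
  | .cons f g => .lam (.letin (.app (compile σ f) (.var 0)) (.letin (.app (compile σ g) (.var 1))
      (.ret (consV σ (headV (.var 1)) (.var 0)))))
  | .comp f g => .lam (.letin (.app (compile σ g) (.var 0)) (.app (compile σ f) (.var 0)))
  | .case f g => .lam (ifz σ (.app (headV (.var 0)) (.num 0))
      (.app (compile σ f) (tailV σ (.var 0)))
      (.app (compile σ g) (consV σ (predV σ (headV (.var 0))) (tailV σ (.var 0)))))
  | .fix f => .fix (.lam (.letin (.app (compile σ f) (.var 0))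
      (ifz σ (.app (headV (.var 0)) (.num 0)) (.ret (tailV σ (.var 0)))
        (.app (.var 2) (tailV σ (.var 0))))))

/-- Compiled code is closed. -/
theorem compile_subst (c : Code) (s : ℕ → Val S) : (compile σ c).subst s = compile σ c := by
  induction c generalizing s with
  | _ => simp_all [compile, Val.subst, Comp.subst, ifz_subst, consV_subst, succV_subst, predV_subst,
      headV_subst, tailV_subst, zeroV_subst, nilV_subst, Val.ren]

theorem steps_compile_cons (f g : Code) (l : Val S) :
    Steps (.app (compile σ (.cons f g)) l) (.letin (.app (compile σ f) l)
      (.letin (.app (compile σ g) (l.ren Nat.succ)) (.ret (consV σ (headV (.var 1)) (.var 0))))) := by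
  refine .single ?_
  rw [compile]
  convert Step.beta _ l using 1
  simp [Comp.inst, Comp.subst, Val.subst, compile_subst, consV_subst, headV_subst, Val.ren]

theorem steps_compile_comp (f g : Code) (l : Val S) :
    Steps (.app (compile σ (.comp f g)) l)
      (.letin (.app (compile σ g) l) (.app (compile σ f) (.var 0))) := by
  refine .single ?_
  rw [compile]
  convert Step.beta _ l using 1
  simp [Comp.inst, Comp.subst, Val.subst, compile_subst]

theorem steps_compile_case (f g : Code) (l : Val S) :
    Steps (.app (compile σ (.case f g)) l) (ifz σ (.app (headV l) (.num 0))
      (.app (compile σ f) (tailV σ l))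
      (.app (compile σ g) (consV σ (predV σ (headV l)) (tailV σ l)))) := by
  refine .single ?_
  rw [compile]
  convert Step.beta _ l using 1
  simp [Comp.inst, Comp.subst, Val.subst, compile_subst, ifz_subst, consV_subst, headV_subst,
    predV_subst, tailV_subst]

theorem RepList.steps_case_zero {l : Val S} {v : List ℕ} (h : RepList σ l v) (hv : v.headI = 0)
    (f g : Code) :
    Steps (.app (compile σ (.case f g)) l) (.app (compile σ f) (tailV σ l)) :=
  (steps_compile_case f g l).trans (h.ifz_zero hv _ _)

theorem RepList.steps_case_succ {l : Val S} {v : List ℕ} {n : ℕ} (h : RepList σ l v)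
    (hv : v.headI = n + 1) (f g : Code) :
    Steps (.app (compile σ (.case f g)) l)
      (.app (compile σ g) (consV σ (predV σ (headV l)) (tailV σ l))) :=
  (steps_compile_case f g l).trans (h.ifz_succ hv _ _)

/-- The loop body of `compile σ (.fix f)`, after the call of `f`. -/
def fixRest (σ : S.Op) (F x : Val S) : Comp S :=
  ifz σ (.app (headV x) (.num 0)) (.ret (tailV σ x)) (.app F (tailV σ x))

theorem fixRest_subst (F x : Val S) (s : ℕ → Val S) :
    (fixRest σ F x).subst s = fixRest σ (F.subst s) (x.subst s) := by
  simp [fixRest, ifz_subst, Comp.subst, Val.subst, headV_subst, tailV_subst]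

/-- The beginning of a round of the loop, up to the call of `f`. The first step is singled out so
that rounds are seen to be nonempty, which the induction on termination needs. -/
theorem step_compile_fix (f : Code) (l : Val S) :
    ∃ C, Step (.app (compile σ (.fix f)) l) C ∧ Steps C (.letin (.app (compile σ f) l)
      (fixRest σ ((compile σ (.fix f)).ren Nat.succ) (.var 0))) := by
  have hF (ρ : ℕ → ℕ) : (compile σ (.fix f)).ren ρ = compile σ (.fix f) := by
    rw [Val.ren_eq_subst, compile_subst]
  have h : compile σ (.fix f) = .fix (.lam (.letin (.app (compile σ f) (.var 0))
      (fixRest σ (.var 2) (.var 0)))) := rfl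
  refine ⟨.app (.lam (.letin (.app (compile σ f) (.var 0))
    (fixRest σ (compile σ (.fix f)) (.var 0)))) l, ?_, .single ?_⟩
  · conv_lhs => rw [h]
    convert Step.fix _ l using 2
    rw [← h]
    simp [Val.inst, Comp.subst, Val.subst, fixRest_subst, compile_subst, hF]
  · convert Step.beta _ l using 1
    simp [Comp.inst, Comp.subst, Val.subst, fixRest_subst, compile_subst, hF]

theorem fixRest_inst (F x : Val S) :
    (fixRest σ (F.ren Nat.succ) (.var 0)).inst x = fixRest σ F x := by
  simp [Comp.inst, fixRest_subst, Val.subst_scons_shift, Val.subst]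

/-- A round of the loop in which the call of `f` returns `x`. -/
theorem steps_compile_fix {f : Code} {l x : Val S}
    (h : Steps (.app (compile σ f) l) (.ret x)) :
    ∃ C, Step (.app (compile σ (.fix f)) l) C ∧
      Steps C (fixRest σ (compile σ (.fix f)) x) := by
  obtain ⟨C, hC, hC'⟩ := step_compile_fix (σ := σ) f l
  refine ⟨C, hC, ?_⟩
  rw [← fixRest_inst]
  exact hC'.trans (Steps.letin_ret h _)

/-- Compiled code computes what the code computes. -/
theorem RepList.compile_of_mem_eval (c : Code) {v v' : List ℕ} {l : Val S} (h : RepList σ l v)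
    (hc : v' ∈ c.eval v) :
    ∃ l', Steps (.app (compile σ c) l) (.ret l') ∧ RepList σ l' v' := by
  induction c generalizing v v' l with
  | zero' =>
    simp only [Code.zero'_eval, Part.pure_eq_some, Part.mem_some_iff] at hc
    subst hc
    refine ⟨consV σ (zeroV S) l, .single ?_, h.cons repNat_zeroV⟩
    rw [compile]
    convert Step.beta _ l using 1
    simp [Comp.inst, Comp.subst, Val.subst, consV_subst, zeroV_subst]
  | succ =>
    simp only [Code.succ_eval, Part.pure_eq_some, Part.mem_some_iff] at hc
    subst hc
    refine ⟨consV σ (succV σ (headV l)) (nilV S), .single ?_, repList_nilV.cons h.head.succ⟩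
    rw [compile]
    convert Step.beta _ l using 1
    simp [Comp.inst, Comp.subst, Val.subst, consV_subst, succV_subst, headV_subst, nilV_subst]
  | tail =>
    simp only [Code.tail_eval, Part.pure_eq_some, Part.mem_some_iff] at hc
    subst hc
    refine ⟨tailV σ l, .single ?_, h.tail⟩
    rw [compile]
    convert Step.beta _ l using 1
    simp [Comp.inst, Comp.subst, Val.subst, tailV_subst]
  | cons f g hf hg =>
    simp only [Code.cons_eval, Part.pure_eq_some, Part.bind_eq_bind, Part.mem_bind_iff,
      Part.mem_some_iff] at hc
    obtain ⟨n, hn, ns, hns, rfl⟩ := hc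
    obtain ⟨x, hx, hxn⟩ := hf h hn
    obtain ⟨y, hy, hyn⟩ := hg h hns
    refine ⟨consV σ (headV x) y, ?_, hyn.cons hxn.head⟩
    refine (steps_compile_cons f g l).trans ((Steps.letin_ret hx _).trans ?_)
    simpa [Comp.inst, Comp.subst, Val.subst, compile_subst, Val.subst_scons_shift, consV_subst,
      headV_subst] using Steps.letin_ret hy (.ret (consV σ (headV (x.ren Nat.succ)) (.var 0)))
  | comp f g hf hg =>
    rw [Code.comp_eval] at hc
    replace hc := Part.mem_bind_iff.1 hc
    obtain ⟨w, hw, hv'⟩ := hc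
    obtain ⟨x, hx, hxw⟩ := hg h hw
    obtain ⟨y, hy, hyv⟩ := hf hxw hv'
    refine ⟨y, (steps_compile_comp f g l).trans ((Steps.letin_ret hx _).trans ?_), hyv⟩
    simpa [Comp.inst, Comp.subst, Val.subst, compile_subst] using hy
  | case f g hf hg =>
    simp only [Code.case_eval] at hc
    rcases hv : v.headI with _ | n
    · obtain ⟨x, hx, hxv⟩ := hf h.tail (by simpa [hv] using hc)
      exact ⟨x, (h.steps_case_zero hv f g).trans hx, hxv⟩
    · obtain ⟨x, hx, hxv⟩ := hg (h.tail.cons h.head.pred) (by simpa [hv] using hc)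
      exact ⟨x, (h.steps_case_succ hv f g).trans hx, hxv⟩
  | fix f hf =>
    rw [Code.fix_eval] at hc
    -- Induction on the number of rounds.
    refine PFun.fixInduction' (C := fun v => ∀ l, RepList σ l v →
      ∃ l', Steps (.app (compile σ (.fix f)) l) (.ret l') ∧ RepList σ l' v') hc ?_ ?_ l h
    · intro v hv l h
      obtain ⟨w, hw, hwv⟩ := (Part.mem_map_iff _).1 hv
      obtain ⟨x, hx, hxw⟩ := hf h hw
      obtain ⟨C, hC, hC'⟩ := steps_compile_fix hx
      split at hwv
      next h0 =>
        cases hwv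
        exact ⟨_, .head hC (hC'.trans (hxw.ifz_zero h0 _ _)), hxw.tail⟩
      next => cases hwv
    · intro v v₁ _ hv ih l h
      obtain ⟨w, hw, hwv⟩ := (Part.mem_map_iff _).1 hv
      obtain ⟨x, hx, hxw⟩ := hf h hw
      obtain ⟨C, hC, hC'⟩ := steps_compile_fix hx
      split at hwv
      next => cases hwv
      next h0 =>
        cases hwv
        obtain ⟨n, hn⟩ := Nat.exists_eq_succ_of_ne_zero h0
        obtain ⟨l', hl', hv'⟩ := ih _ hxw.tail
        exact ⟨l', .head hC ((hC'.trans (hxw.ifz_succ hn _ _)).trans hl'),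
          hv'⟩

/-- Compiled code terminates only where the code is defined. -/
theorem RepList.dom_of_terminates (c : Code) {v : List ℕ} {l : Val S} (h : RepList σ l v)
    (hc : (Comp.app (compile σ c) l).Terminates) : (c.eval v).Dom := by
  induction c generalizing v l with
  | zero' => simp
  | succ => simp
  | tail => simp
  | cons f g hf hg =>
    have ht := hc.steps (steps_compile_cons f g l)
    have hfd := hf h ht.of_letin
    obtain ⟨x, hx, -⟩ := h.compile_of_mem_eval f (Part.get_mem hfd)
    have ht' := ht.steps (Steps.letin_ret hx _)
    simp only [Comp.inst, Comp.subst, compile_subst, Val.subst_scons_shift] at ht'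
    have hgd := hg h ht'.of_letin
    simp [Code.cons_eval, hfd, hgd]
  | comp f g hf hg =>
    have ht := hc.steps (steps_compile_comp f g l)
    have hgd := hg h ht.of_letin
    obtain ⟨x, hx, hxv⟩ := h.compile_of_mem_eval g (Part.get_mem hgd)
    have ht' := ht.steps (Steps.letin_ret hx _)
    simp only [Comp.inst, Comp.subst, compile_subst, Val.subst, scons_zero] at ht'
    rw [Code.comp_eval]
    exact Part.bind_dom.2 ⟨hgd, hf hxv ht'⟩
  | case f g hf hg =>
    simp only [Code.case_eval]
    rcases hv : v.headI with _ | n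
    · exact hf h.tail (hc.steps (h.steps_case_zero hv f g))
    · have := hg (h.tail.cons h.head.pred) (hc.steps (h.steps_case_succ hv f g))
      simpa [hv] using this
  | fix f hf =>
    -- Well-founded induction along the reduction sequence: a further round of the loop starts at a
    -- computation that is reached after at least one step.
    suffices H : ∀ C : Comp S, C.Terminates → ∀ l v, RepList σ l v →
        Steps C (.app (compile σ (.fix f)) l) → ((Code.fix f).eval v).Dom from
      H _ hc l v h .refl
    intro C hC
    induction hC with
    | intro C hC ih =>
      intro l v h hs
      rcases hs.cases_head with rfl | ⟨C', hC', hs'⟩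
      · have hfd : (f.eval v).Dom := by
          obtain ⟨C', hC', hs'⟩ := step_compile_fix (σ := σ) f l
          exact hf h (Comp.Terminates.steps (hC C' hC') hs').of_letin
        obtain ⟨x, hx, hxw⟩ := h.compile_of_mem_eval f (Part.get_mem hfd)
        obtain ⟨C', hC', hs'⟩ := steps_compile_fix hx
        rw [Code.fix_eval, Part.dom_iff_mem]
        rcases hn : ((f.eval v).get hfd).headI with _ | n
        · exact ⟨_, PFun.mem_fix_iff.2 (.inl ((Part.mem_map_iff _).2 ⟨_, Part.get_mem hfd, if_pos hn⟩))⟩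
        · have := ih C' hC' _ _ hxw.tail
            (hs'.trans (hxw.ifz_succ hn _ _))
          rw [Code.fix_eval, Part.dom_iff_mem] at this
          obtain ⟨y, hy⟩ := this
          exact ⟨y, PFun.mem_fix_iff.2 (.inr ⟨_, (Part.mem_map_iff _).2
            ⟨_, Part.get_mem hfd, if_neg (by simp [hn])⟩, hy⟩)⟩
      · exact ih C' hC' l v h hs'

/-! ### Typing of compiled code -/

/-- The type of numbers. -/
abbrev natTy (σ : S.Op) : Ty S := .arrow (.enum 1) {σ} (.ground S.unit)

/-- The type of lists. -/
abbrev listTy (σ : S.Op) : Ty S := .arrow (natTy σ) {σ} (.ground S.unit)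

theorem Val.HasTy.starV (Γ : List (Ty S)) : Val.HasTy Γ S.starV (.ground S.unit) := by
  simpa only [(S.constTy_eq_unit S.star).2 rfl] using Val.HasTy.const Γ S.star

theorem Val.HasTy.var_zero (Γ : List (Ty S)) (T : Ty S) : Val.HasTy (T :: Γ) (.var 0) T :=
  .var _ _ _ rfl

theorem Val.HasTy.var_one (Γ : List (Ty S)) (T U : Ty S) : Val.HasTy (U :: T :: Γ) (.var 1) T :=
  .var _ _ _ rfl

theorem Val.HasTy.var_two (Γ : List (Ty S)) (T U U' : Ty S) :
    Val.HasTy (U' :: U :: T :: Γ) (.var 2) T :=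
  .var _ _ _ rfl

theorem Comp.HasTy.app_num {Γ : List (Ty S)} {E : Finset S.Op} {V : Val S} {k n : ℕ} {T : Ty S}
    (h : Val.HasTy Γ V (.arrow (.enum k) E T)) (hn : n < k) :
    Comp.HasTy Γ E (.app V (.num n)) T :=
  .app _ _ _ _ _ _ h (.num _ _ _ hn)

theorem Comp.HasTy.case₂ {Γ : List (Ty S)} {E : Finset S.Op} {V : Val S} {C₀ C₁ : Comp S}
    {T : Ty S} (hV : Val.HasTy Γ V (.enum 2)) (h₀ : Comp.HasTy Γ E C₀ T)
    (h₁ : Comp.HasTy Γ E C₁ T) : Comp.HasTy Γ E (case₂ V C₀ C₁) T :=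
  .case _ _ _ _ _ _ hV fun i => by split <;> assumption

variable {Γ : List (Ty S)}

theorem Comp.HasTy.ifz {C D₀ D₁ : Comp S} {T U : Ty S}
    (hC : Comp.HasTy Γ {σ} C U) (h₀ : Comp.HasTy Γ {σ} D₀ T) (h₁ : Comp.HasTy Γ {σ} D₁ T) :
    Comp.HasTy Γ {σ} (ifz σ C D₀ D₁) T :=
  .letin _ _ _ _ (.enum 2) _
    (.handle _ _ _ _ _ _ U _ (.ret _ _ _ _ (.num _ _ _ (by decide)))
      (fun _ => .ret _ _ _ _ (.num _ _ _ (by decide))) hC)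
    (.case₂ (.var_zero _ _) (h₀.shift _) (h₁.shift _))

theorem Val.HasTy.thunk_ret_starV (T : Ty S) (E : Finset S.Op) :
    Val.HasTy Γ (.lam (.ret S.starV)) (.arrow T E (.ground S.unit)) :=
  .lam _ _ _ _ _ (.ret _ _ _ _ (.starV _))

theorem Comp.HasTy.op_starV (hσ : S.opParam σ = S.unit) (hσ' : S.opArity σ = 1) {C : Comp S}
    {T : Ty S} (h : Comp.HasTy (.enum 1 :: Γ) {σ} C T) :
    Comp.HasTy Γ {σ} (.op σ S.starV C) T :=
  .op _ _ _ _ _ _ (Finset.mem_singleton_self σ) (hσ ▸ .starV _) (hσ' ▸ h)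

theorem Val.HasTy.succV (hσ : S.opParam σ = S.unit) (hσ' : S.opArity σ = 1) {a : Val S}
    (h : Val.HasTy Γ a (natTy σ)) : Val.HasTy Γ (succV σ a) (natTy σ) :=
  .lam _ _ _ _ _ (.op_starV hσ hσ' (.app_num ((h.shift _).shift _) (by decide)))

theorem Val.HasTy.predStep (hσ : S.opParam σ = S.unit) (hσ' : S.opArity σ = 1) {R : Val S}
    {T : Ty S} (h : Val.HasTy Γ R (.arrow (.enum 1) {σ} (.arrow (.enum 2) {σ} T))) :
    Val.HasTy Γ (predStep σ R) (.arrow (.enum 2) {σ} T) :=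
  .lam _ _ _ _ _ (.case₂ (.var_zero _ _)
    (.letin _ _ _ _ _ _ (.app_num (h.shift _) (by decide)) (.app_num (.var_zero _ _) (by decide)))
    (.op_starV hσ hσ' (.letin _ _ _ _ _ _ (.app_num ((h.shift _).shift _) (by decide))
      (.app_num (.var_zero _ _) (by decide)))))

theorem Comp.HasTy.predH (hσ : S.opParam σ = S.unit) (hσ' : S.opArity σ = 1) {C : Comp S}
    {U : Ty S} (h : Comp.HasTy Γ {σ} C U) :
    Comp.HasTy Γ {σ} (predH σ C) (.arrow (.enum 2) {σ} (.ground S.unit)) := by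
  refine .handle _ _ _ _ _ _ U _ (.ret _ _ _ _ (.thunk_ret_starV _ _)) (fun τ => ?_) h
  obtain ⟨τ, hτ⟩ := τ
  obtain rfl := Finset.mem_singleton.1 hτ
  rw [hσ']
  exact .ret _ _ _ _ (.predStep hσ hσ' (.var_zero _ _))

theorem Val.HasTy.predV (hσ : S.opParam σ = S.unit) (hσ' : S.opArity σ = 1) {a : Val S}
    (h : Val.HasTy Γ a (natTy σ)) : Val.HasTy Γ (predV σ a) (natTy σ) :=
  .lam _ _ _ _ _ (.letin _ _ _ _ _ _ (.predH hσ hσ' (.app_num (h.shift _) (by decide)))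
    (.app_num (.var_zero _ _) (by decide)))

theorem Val.HasTy.headV {l : Val S} (h : Val.HasTy Γ l (listTy σ)) :
    Val.HasTy Γ (headV l) (natTy σ) :=
  .lam _ _ _ _ _ (.app _ _ _ _ _ _ (h.shift _) (.thunk_ret_starV _ _))

theorem Val.HasTy.tailV (hσ : S.opParam σ = S.unit) (hσ' : S.opArity σ = 1) {l : Val S}
    (h : Val.HasTy Γ l (listTy σ)) : Val.HasTy Γ (tailV σ l) (listTy σ) :=
  .lam _ _ _ _ _ (.app _ _ _ _ _ _ (h.shift _) (.succV hσ hσ' (.var_zero _ _)))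

theorem Val.HasTy.consV (hσ : S.opParam σ = S.unit) (hσ' : S.opArity σ = 1) {a l : Val S}
    (ha : Val.HasTy Γ a (natTy σ)) (hl : Val.HasTy Γ l (listTy σ)) :
    Val.HasTy Γ (consV σ a l) (listTy σ) :=
  .lam _ _ _ _ _ (.ifz (.app_num (.var_zero _ _) (by decide))
    (.app_num (ha.shift _) (by decide))
    (.app _ _ _ _ _ _ (hl.shift _) (.predV hσ hσ' (.var_zero _ _))))

theorem Val.HasTy.compile (hσ : S.opParam σ = S.unit) (hσ' : S.opArity σ = 1) (c : Code) :
    Val.HasTy Γ (compile σ c) (.arrow (listTy σ) {σ} (listTy σ)) := by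
  induction c generalizing Γ with
  | zero' =>
    exact .lam _ _ _ _ _ (.ret _ _ _ _
      (.consV hσ hσ' (.thunk_ret_starV _ _) (.var_zero _ _)))
  | succ =>
    exact .lam _ _ _ _ _ (.ret _ _ _ _
      (.consV hσ hσ' (.succV hσ hσ' (.headV (.var_zero _ _))) (.thunk_ret_starV _ _)))
  | tail => exact .lam _ _ _ _ _ (.ret _ _ _ _ (.tailV hσ hσ' (.var_zero _ _)))
  | cons f g hf hg =>
    exact .lam _ _ _ _ _ (.letin _ _ _ _ _ _ (.app _ _ _ _ _ _ hf (.var_zero _ _))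
      (.letin _ _ _ _ _ _ (.app _ _ _ _ _ _ hg (.var_one _ _ _))
        (.ret _ _ _ _ (.consV hσ hσ' (.headV (.var_one _ _ _)) (.var_zero _ _)))))
  | comp f g hf hg =>
    exact .lam _ _ _ _ _ (.letin _ _ _ _ _ _ (.app _ _ _ _ _ _ hg (.var_zero _ _))
      (.app _ _ _ _ _ _ hf (.var_zero _ _)))
  | case f g hf hg =>
    exact .lam _ _ _ _ _ (.ifz (.app_num (.headV (.var_zero _ _)) (by decide))
      (.app _ _ _ _ _ _ hf (.tailV hσ hσ' (.var_zero _ _)))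
      (.app _ _ _ _ _ _ hg (.consV hσ hσ' (.predV hσ hσ' (.headV (.var_zero _ _)))
        (.tailV hσ hσ' (.var_zero _ _)))))
  | fix f hf =>
    exact .fix _ _ _ _ _ (.lam _ _ _ _ _ (.letin _ _ _ _ _ _
      (.app _ _ _ _ _ _ hf (.var_zero _ _))
      (.ifz (.app_num (.headV (.var_zero _ _)) (by decide))
        (.ret _ _ _ _ (.tailV hσ hσ' (.var_zero _ _)))
        (.app _ _ _ _ _ _ (.var_two _ _ _ _) (.tailV hσ hσ' (.var_zero _ _))))))

/-! ### Programs that diverge if and only if a code is undefined -/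

variable (σ)

/-- The number `n`. -/
def numeral : ℕ → Val S
  | 0 => zeroV S
  | n + 1 => succV σ (numeral n)

/-- The function of `x` that runs the compiled code on the list `[x]` and discards the result. -/
def haltBody (c : Code) : Comp S :=
  .letin (.app (compile σ c) (consV σ (.var 0) (nilV S))) (.ret S.starV)

/-- The computation that runs the compiled code on the list `[n]` and discards the result. -/
def haltComp (c : Code) (n : ℕ) : Comp S := .letin (.ret (numeral σ n)) (haltBody σ c)

variable {σ}

theorem repNat_numeral (n : ℕ) : RepNat σ (numeral σ n) n := by
  induction n with
  | zero => exact repNat_zeroV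
  | succ n ih => exact ih.succ

theorem numeral_subst (n : ℕ) (s : ℕ → Val S) : (numeral σ n).subst s = numeral σ n := by
  induction n with
  | zero => rfl
  | succ n ih => rw [numeral, succV_subst, ih]

theorem haltComp_hasTy (hσ : S.opParam σ = S.unit) (hσ' : S.opArity σ = 1) (c : Code) (n : ℕ) :
    Comp.HasTy [] {σ} (haltComp σ c n) (.ground S.unit) := by
  have hn : Val.HasTy [] (numeral σ n) (natTy σ) := by
    induction n with
    | zero => exact .thunk_ret_starV _ _
    | succ n ih => exact .succV hσ hσ' ih
  exact .letin _ _ _ _ _ _ (.ret _ _ _ _ hn) (.letin _ _ _ _ _ _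
    (.app _ _ _ _ _ _ (.compile hσ hσ' c)
      (.consV hσ hσ' (.var_zero _ _) (.thunk_ret_starV _ _))) (.ret _ _ _ _ (.starV _)))

theorem steps_haltComp (c : Code) (n : ℕ) :
    Steps (haltComp σ c n)
      (.letin (.app (compile σ c) (consV σ (numeral σ n) (nilV S))) (.ret S.starV)) := by
  have := Step.letRet (numeral σ n) (haltBody σ c)
  simp only [Comp.inst, haltBody, Comp.subst, compile_subst, consV_subst, nilV_subst, Val.subst,
    scons_zero] at this
  exact .single this

theorem repList_singleton (n : ℕ) : RepList σ (consV σ (numeral σ n) (nilV S)) [n] :=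
  repList_nilV.cons (repNat_numeral n)

theorem steps_haltComp_ret {c : Code} {n : ℕ} (h : (c.eval [n]).Dom) :
    Steps (haltComp σ c n) (.ret S.starV) := by
  obtain ⟨x, hx, -⟩ := (repList_singleton n).compile_of_mem_eval (σ := σ) c (Part.get_mem h)
  exact (steps_haltComp c n).trans (Steps.letin_ret hx _)

theorem dom_of_terminates_haltComp {c : Code} {n : ℕ} (h : (haltComp σ c n).Terminates) :
    (c.eval [n]).Dom :=
  (repList_singleton n).dom_of_terminates c (h.steps (steps_haltComp c n)).of_letin

/-- Numerals are closed, so weakening leaves them unchanged and the Gödel number of a successor is a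
function of that of its predecessor. -/
theorem primrec_code_numeral : Primrec fun n => (numeral σ n).code := by
  have h : ∀ n, (numeral σ n).code = Nat.rec (zeroV S).code
      (fun _ a => Nat.pair 3 (Nat.pair 1 (Nat.pair σ (Nat.pair (Nat.pair 0 S.star)
        (Nat.pair 0 (Nat.pair a (Nat.pair 1 0))))))) n := by
    intro n
    induction n with
    | zero => rfl
    | succ n ih =>
      simp only [← ih, numeral, succV, Val.ren_eq_subst, numeral_subst, Val.code, Comp.code]
  refine (Primrec.nat_rec₁ (f := fun _ a => Nat.pair 3 (Nat.pair 1 (Nat.pair σ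
    (Nat.pair (Nat.pair 0 S.star) (Nat.pair 0 (Nat.pair a (Nat.pair 1 0))))))) (zeroV S).code
      ?_).of_eq fun n => (h n).symm
  have hp (k : ℕ) {f : ℕ × ℕ → ℕ} (hf : Primrec f) : Primrec fun x => Nat.pair k (f x) :=
    Primrec₂.natPair.comp (Primrec.const k) hf
  exact hp _ (hp _ (hp _ (hp _ (hp _ (Primrec₂.natPair.comp .snd (.const _))))))

theorem computable_code_haltComp (c : Code) : Computable fun n => (haltComp σ c n).code :=
  (Primrec₂.natPair.comp (.const 3) (Primrec₂.natPair.comp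
    (Primrec₂.natPair.comp (.const 2) primrec_code_numeral) (.const (haltBody σ c).code))).to_comp

end HEPCF

/-! ### An automaton that accepts the trees containing `⊥` -/

namespace PosBool

/-- A disjunction of atoms. -/
def disj {X : Type} : List X → PosBool X
  | [] => .ff
  | x :: l => .or (.atom x) (disj l)

theorem sat_disj {X : Type} {Y : Set X} {l : List X} : (disj l).Sat Y ↔ ∃ x ∈ l, x ∈ Y := by
  induction l with
  | nil => simp [disj, Sat]
  | cons x l ih => simp [disj, Sat, ih]

end PosBool

namespace RankedAlphabet

theorem Tree.subtree_append {F : RankedAlphabet} (t : F.Tree) (α β : List ℕ) :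
    t.subtree (α ++ β) = (t.subtree α).bind fun u => u.subtree β := by
  induction α generalizing t with
  | nil => rfl
  | cons i α ih =>
    simp only [List.cons_append, Tree.subtree]
    split
    · exact ih _
    · rfl

end RankedAlphabet

namespace APT

variable {F : RankedAlphabet}

/-- The automaton that moves to some child until it reaches `⊥`. Its only priority is odd, so it
has to reach `⊥`. -/
def botSearch (F : RankedAlphabet) : APT F where
  numStates := 1
  init := 0
  δ _
    | none => .tt
    | some f => .disj ((List.finRange (F.ar f)).map fun i => (i, 0))
  Ω _ := 1

theorem exists_sat_botSearch {q : Fin (botSearch F).numStates} {s : Option F.Sym} (hs : s ≠ none)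
    {Y : Set (Fin (F.arBot s) × Fin (botSearch F).numStates)}
    (h : ((botSearch F).δ q s).Sat Y) : ∃ m, m ∈ Y := by
  cases s with
  | none => exact absurd rfl hs
  | some f =>
    obtain ⟨m, -, hm⟩ := PosBool.sat_disj.1 h
    exact ⟨m, hm⟩

theorem hasBot_of_accepts_botSearch {t : F.Tree} (h : (botSearch F).Accepts t) : t.HasBot := by
  obtain ⟨R, hR, hpar⟩ := h
  by_contra hb
  -- Without `⊥`, every node of the run has a child, which gives an infinite branch.
  have hstep : ∀ p : R, ∃ m, p.1 ++ [m] ∈ R := by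
    rintro ⟨p, hp⟩
    obtain ⟨u, hu, Y, hY, hYR⟩ := hR.step p hp
    obtain ⟨m, hm⟩ := exists_sat_botSearch (fun h0 => hb ⟨_, u, hu, h0⟩) hY
    exact ⟨_, hYR m hm⟩
  choose m hm using hstep
  let p : ℕ → R := fun n => Nat.rec ⟨[], hR.root_mem⟩ (fun _ p => ⟨p.1 ++ [m p], hm p⟩) n
  have hp : ∀ n, (List.range n).map (fun k => m (p k)) = (p n).1 := by
    intro n
    induction n with
    | zero => rfl
    | succ n ih => simp only [List.range_succ, List.map_append, ih]; rfl
  obtain ⟨k, ⟨hk, -⟩, hk'⟩ := hpar (fun k => m (p k)) fun n => hp n ▸ (p n).2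
  obtain ⟨_, hk⟩ := Filter.Frequently.exists hk
  have : (1 : ℕ) = k := hk
  subst this
  exact absurd hk' (by decide)

theorem botSearch_accepts_of_hasBot {t : F.Tree} (h : t.HasBot) : (botSearch F).Accepts t := by
  obtain ⟨α, u, hu, hbot⟩ := h
  -- The run consists of the positions on the path to `⊥`.
  refine ⟨{p | RunNode.pos p <+: α}, ⟨List.nil_prefix, ?_, ?_⟩, ?_⟩
  · intro p m hp
    refine List.IsPrefix.trans ?_ hp
    simp [RunNode.pos]
  · rintro p ⟨β, hβ⟩
    rw [← hβ, RankedAlphabet.Tree.subtree_append] at hu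
    obtain ⟨w, hw, hwu⟩ := Option.bind_eq_some_iff.1 hu
    refine ⟨w, hw, ?_⟩
    cases β with
    | nil =>
      obtain rfl : w = u := by simpa [RankedAlphabet.Tree.subtree] using hwu
      refine ⟨∅, ?_, by simp⟩
      rw [hbot]
      trivial
    | cons i β =>
      rw [RankedAlphabet.Tree.subtree] at hwu
      split at hwu
      next hi =>
        refine ⟨{(⟨i, hi⟩, (botSearch F).init)}, ?_, ?_⟩
        · clear hwu
          generalize w.root = s at hi
          cases s with
          | none => trivial
          | some f =>
            exact PosBool.sat_disj.2 ⟨_, List.mem_map_of_mem (List.mem_finRange ⟨i, hi⟩), rfl⟩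
        · rintro m rfl
          exact ⟨β, by simp [RunNode.pos] at hβ ⊢; exact hβ⟩
      next => cases hwu
  · intro w hw
    have := (hw (α.length + 1)).length_le
    simp [RunNode.pos] at this

theorem botSearch_accepts_iff {t : F.Tree} : (botSearch F).Accepts t ↔ t.HasBot :=
  ⟨hasBot_of_accepts_botSearch, botSearch_accepts_of_hasBot⟩

/-- An automaton over a finite alphabet has a Gödel number. -/
theorem exists_isCode [Finite F.Sym] (symCode : F.Sym → ℕ) (A : APT F) :
    ∃ n, A.IsCode symCode n := by
  have hfin : (Set.range fun x : Fin A.numStates × Option F.Sym =>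
      ((x.1 : ℕ), Encodable.encode (x.2.map symCode),
        (A.δ x.1 x.2).code fun m => Nat.pair m.1 m.2)).Finite := Set.finite_range _
  refine ⟨_, hfin.toFinset.toList, fun e => ?_, rfl⟩
  simp [eq_comm]

end APT

namespace HEPCF
variable {S : Lang}
open Turing.ToPartrec (Code)

/-! ### Effect trees of unit type -/

/-- The only closed value of unit type is `()`, so that the signature of effect trees is finite. -/
theorem Val.HasTy.eq_starV {V : Val S} (h : Val.HasTy [] V (.ground S.unit)) : V = S.starV := by
  generalize hΓ : ([] : List (Ty S)) = Γ at h
  generalize hT : Ty.ground S.unit = T at h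
  cases h with
  | const _ v => rw [(S.constTy_eq_unit v).1 (Ty.ground.inj hT).symm]
  | var _ x _ h => subst hΓ; simp at h
  | _ => cases hT

instance (E : Finset S.Op) : Finite (effSig S E (.ground S.unit)).Sym := by
  refine Finite.of_surjective (α := {σ // σ ∈ E} ⊕ Unit ⊕ S.Const)
    (Sum.elim EffSym.op (Sum.elim (fun _ => EffSym.ret ⟨_, .starV _⟩) EffSym.param)) ?_
  rintro (τ | ⟨V, hV⟩ | v)
  · exact ⟨.inl τ, rfl⟩
  · obtain rfl := hV.eq_starV
    exact ⟨.inr (.inl ()), rfl⟩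
  · exact ⟨.inr (.inr v), rfl⟩

theorem root_effectTree (E : Finset S.Op) (T : Ty S) (C : Comp S) :
    (effectTree E T C).root = (effStep E T (.inl C)).1 := by
  rw [effectTree, RankedAlphabet.Tree.root, PFunctor.M.corec_def, PFunctor.M.head_mk]
  rfl

theorem not_hasBot_of_steps_ret {E : Finset S.Op} {T : Ty S} {C : Comp S} {V : Val S}
    (hV : Val.HasTy [] V T) (h : Steps C (.ret V)) : ¬ (effectTree E T C).HasBot := by
  have h' : ∃ V : {V : Val S // Val.HasTy [] V T}, Steps C (.ret V) := ⟨⟨V, hV⟩, h⟩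
  have hroot : (effectTree E T C).root = some (.ret h'.choose) := by
    rw [root_effectTree]
    exact congrArg Sigma.fst (dif_pos h')
  rintro ⟨α, u, hu, hbot⟩
  cases α with
  | nil =>
    obtain rfl : _ = u := by simpa [RankedAlphabet.Tree.subtree] using hu
    simp [hroot] at hbot
  | cons i α =>
    rw [RankedAlphabet.Tree.subtree] at hu
    split at hu
    next hi =>
      rw [hroot] at hi
      exact absurd hi (Nat.not_lt_zero i)
    next => cases hu

/-- A computation that has an infinite reduction sequence reaches no normal form, by determinism, so
that `⊥` is the root of its effect tree. -/
theorem hasBot_of_not_terminates {E : Finset S.Op} {T : Ty S} {C : Comp S}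
    (h : ¬ C.Terminates) : (effectTree E T C).HasBot := by
  refine ⟨[], _, rfl, ?_⟩
  rw [root_effectTree]
  have hret : ¬ ∃ V : {V : Val S // Val.HasTy [] V T}, Steps C (.ret V) := by
    rintro ⟨V, hV⟩
    exact h (Comp.terminates_of_steps_normal hV (by rintro _ ⟨⟩))
  have hop : ¬ ∃ p : {σ // σ ∈ E} × S.Const × Comp S,
      Steps C (.op p.1 (.const p.2.1) p.2.2) := by
    rintro ⟨p, hp⟩
    exact h (Comp.terminates_of_steps_normal hp (by rintro _ ⟨⟩))
  exact (congrArg Sigma.fst (dif_neg hret)).trans (congrArg Sigma.fst (dif_neg hop))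

theorem hasBot_haltComp_iff {σ : S.Op} {c : Code} {n : ℕ} :
    (effectTree {σ} (.ground S.unit) (haltComp σ c n)).HasBot ↔ ¬ (c.eval [n]).Dom :=
  ⟨fun h hd => not_hasBot_of_steps_ret (.starV _) (steps_haltComp_ret hd) h,
    fun h => hasBot_of_not_terminates fun ht => h (dom_of_terminates_haltComp ht)⟩

/-! ### Undecidability -/

/-- The universal partial function `n ↦ eval n 0` has a code for functions on lists, and its domain
is the halting problem. -/
theorem exists_code_dom_not_computable :
    ∃ c : Code, ¬ ComputablePred fun n : ℕ => (c.eval [n]).Dom := by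
  have hu : Partrec fun n : ℕ => Nat.Partrec.Code.eval (Denumerable.ofNat _ n) 0 :=
    Nat.Partrec.Code.eval_part.comp (Computable.ofNat _) (Computable.const 0)
  obtain ⟨c, hc⟩ := Turing.ToPartrec.Code.exists_code (Nat.Partrec'.part_iff₁.2 hu)
  have hdom (n : ℕ) : (c.eval [n]).Dom ↔
      (Nat.Partrec.Code.eval (Denumerable.ofNat _ n) 0).Dom := by
    have := hc (n ::ᵥ .nil)
    rw [show ((n ::ᵥ .nil : List.Vector ℕ 1)).1 = [n] from rfl] at this
    rw [this]
    rfl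
  refine ⟨c, fun h => ComputablePred.halting_problem 0 ?_⟩
  obtain ⟨_, h⟩ := h
  refine ⟨fun d => decidable_of_iff _ ((hdom (Encodable.encode d)).trans (by simp)),
    (h.comp Computable.encode).of_eq fun d => ?_⟩
  simp [hdom]

theorem not_algDecidable_hasBot (σ : S.Op) (hσ : S.opParam σ = S.unit)
    (hσ' : S.opArity σ = 1) :
    ¬ AlgDecidable (α := {C : Comp S // Comp.HasTy [] {σ} C (.ground S.unit)})
      (fun C n => n = C.1.code)
      (fun C => (effectTree {σ} (.ground S.unit) C.1).HasBot) := by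
  rintro ⟨f, hf, h⟩
  obtain ⟨c, hc⟩ := exists_code_dom_not_computable
  have h' (n : ℕ) : ∃ b ∈ f (haltComp σ c n).code, (b = true ↔ ¬ (c.eval [n]).Dom) := by
    simpa only [hasBot_haltComp_iff] using
      h ⟨haltComp σ c n, haltComp_hasTy hσ hσ' c n⟩ _ rfl
  choose b hb hb' using h'
  have hbc : Computable b :=
    (hf.comp (computable_code_haltComp c)).of_eq fun n => Part.eq_some_iff.2 (hb n)
  classical
  refine hc ⟨fun n => inferInstance, (Primrec.not.to_comp.comp hbc).of_eq fun n => ?_⟩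
  have := hb' n
  cases hbn : b n <;> simp_all

/-- For a fixed automaton of finite alphabet, deciding whether it accepts the effect tree of a
computation is an instance of model checking. -/
theorem MSODecidable.algDecidable (h : MSODecidable S) {E : Finset S.Op} {T : Ty S}
    [Finite (effSig S E T).Sym] (A : APT (effSig S E T)) :
    AlgDecidable (α := {C : Comp S // Comp.HasTy [] E C T}) (fun C n => n = C.1.code)
      (fun C => A.Accepts (effectTree E T C.1)) := by
  obtain ⟨f, hf, h⟩ := h
  obtain ⟨a, ha⟩ := A.exists_isCode EffSym.code
  refine ⟨fun n => f (Nat.pair n a), hf.comp (Primrec₂.natPair.comp .id (.const a)).to_comp, ?_⟩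
  rintro ⟨C, hC⟩ _ rfl
  exact h ⟨E, T, C, hC, A⟩ _ ⟨a, ha, rfl⟩

end HEPCF

theorem mainTheorem3 (S : HEPCF.Lang) (σ : S.Op)
    (hparam : S.opParam σ = S.unit) (harity : S.opArity σ = 1) :
    ¬ HEPCF.MSODecidable S ∧
    ∃ A : APT (HEPCF.effSig S {σ} (.ground S.unit)),
      (∀ t : (HEPCF.effSig S {σ} (.ground S.unit)).Tree, A.Accepts t ↔ t.HasBot) ∧
      ¬ HEPCF.AlgDecidable
        (α := {C : HEPCF.Comp S // HEPCF.Comp.HasTy [] {σ} C (.ground S.unit)})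
        (fun C n => n = C.1.code)
        (fun C => A.Accepts (HEPCF.effectTree {σ} (.ground S.unit) C.1)) := by
  -- The fixed automaton is the hard case: the uniform problem contains it as a special case.
  have h : ¬ HEPCF.AlgDecidable
      (α := {C : HEPCF.Comp S // HEPCF.Comp.HasTy [] {σ} C (.ground S.unit)})
      (fun C n => n = C.1.code)
      (fun C => (APT.botSearch _).Accepts (HEPCF.effectTree {σ} (.ground S.unit) C.1)) := by
    simpa only [APT.botSearch_accepts_iff] using
      HEPCF.not_algDecidable_hasBot σ hparam harity
  exact ⟨fun hd => h (hd.algDecidable _), _, fun _ => APT.botSearch_accepts_iff, h⟩
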